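/- Let $1\ge g_1\ge g_2\ge\cdots>0$ and $0<r_1\le r_2\le\cdots$ be two real sequences. For $d\ge1$ let $H_{d,\mathbf r,\mathbf g}$ be the weighted Korobov space of all complex-valued $f\in L_2([0,1]^d)$ with $$\|f\|^2=\sum_{\mathbf h\in\mathbb Z^d}\rho(\mathbf h)\,|\hat f(\mathbf h)|^2<\infty,\qquad \rho(\mathbf h)=\prod_{1\le j\le d,\ h_j\ne0} g_j^{-1}|h_j|^{2r_j},\qquad \hat f(\mathbf h)=\int_{[0,1]^d}e^{-2\pi i\,\mathbf h\cdot \mathbf x}f(\mathbf x)\,d\mathbf x,$$ a Hilbert space with inner product $\langle f,u\rangle=\sum_{\mathbf h}\rho(\mathbf h)\hat f(\mathbf h)\overline{\hat u(\mathbf h)}$, and let $\mathrm{APP}_d:H_{d,\mathbf r,\mathbf g}\to L_2([0,1]^d)$, $\mathrm{APP}_df=f$. For $n\ge1$ let $e(n,d)$ be the infimum, over all algorithms $Af=\varphi(L_1f,\dots,L_nf)$ with continuous linear functionals $L_i$ on $H_{d,\mathbf r,\mathbf g}$ and a measurable $\varphi:\mathbb C^n\to L_2([0,1]^d)$, of the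 worst case error $\sup_{\|f\|\le1}\|f-Af\|_{L_2}$; let $e(0,d)=\sup_{\|f\|\le1}\|f\|_{L_2}$. For $\varepsilon\in(0,1)$ the information complexity is $n(\varepsilon,d)=\min\{n\ge 0: e(n,d)\le\varepsilon\,\mathrm{CRI}_d\}$ (this minimum exists), where $\mathrm{CRI}_d=1$ for the absolute error criterion (ABS) and $\mathrm{CRI}_d=e(0,d)$ for the normalized one (NOR). With $d$ ranging over $\{1,2,\dots\}$ and $\varepsilon$ over $(0,1)$, the problem $\mathrm{APP}=\{\mathrm{APP}_d\}$ is - strongly polynomially tractable (SPT) if there are $C,p\ge0$ with $n(\varepsilon,d)\le C\varepsilon^{-p}$ for all $d,\varepsilon$; its exponent $p^*$ is the infimum of such $p$; - polynomially tractable (PT) if there are $C,p,q\ge0$ with $n(\varepsilon,d)\le Cd^q\varepsilon^{-p}$ for all $d,\varepsilon$; - quasi-polynomially tractable (QPT) if there are $C,t>0$ with $n(\varepsilon,d)\le C\exp(t(1+\ln d)(1+\ln\varepsilon^{-1}))$ for all $d,\varepsilon$; its exponent $t^*$ is the infimum of such $t$; - $(s,t)$-weakly tractable ($(s,t)$-WT),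 for $s,t>0$, if $\ln n(\varepsilon,d)/(\varepsilon^{-s}+d^t)\to0$ as $\varepsilon^{-1}+d\to\infty$; weakly tractable (WT) if it is $(1,1)$-WT; uniformly weakly tractable (UWT) if it is $(\alpha,\beta)$-WT for all $\alpha,\beta>0$; - subject to the curse of dimensionality if there are $C,\varepsilon_0,a>0$ such that, for infinitely many $d$, $n(\varepsilon,d)\ge C(1+a)^d$ for all $0<\varepsilon\le\varepsilon_0$. Then, for ABS and for NOR: 1. APP is SPT if and only if $A_*:=\liminf_{k\to\infty}\frac{\ln g_k^{-1}}{\ln k}>0$, and then $p^*=\max\{2/A_*,\,1/r_1\}$. 2. APP is SPT if and only if it is PT. 3. The limit $B:=\lim_{k\to\infty}\ln g_k^{-1}$ exists in $[0,\infty]$. APP is QPT if and only if $B>0$, if and only if $g_k\not\equiv1$, and then $t^*=\max\{2/B,\,1/r_1\}$. 4. APP is QPT if and only if it is UWT, if and only if it is WT, and, for each fixed $s>0$ and $t\in(0,1]$, if and only if it is $(s,t)$-WT. 5. APP is $(s,t)$-WT for all $s>0$ and $t>1$. 6. If $g_k\equiv1$, then APP suffers from the curse of dimensionality. Here $A_*$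 and $B$ may be $\infty$, and $2/\infty:=0$. -/

import Mathlib

open MeasureTheory Filter Topology
open scoped ENNReal NNReal unitInterval

noncomputable section

namespace Tractability

/-! ### Worst case approximation and information complexity -/

section WorstCase

variable {H G : Type*} [NormedAddCommGroup H] [InnerProductSpace ℂ H]
  [NormedAddCommGroup G] [InnerProductSpace ℂ G]

/-- `A` is an algorithm using `n` continuous linear functionals:
`A f = φ (L₁ f, …, Lₙ f)` with `φ` an arbitrary (Borel) measurable mapping. -/
def IsAlgorithm (n : ℕ) (A : H → G) : Prop :=
  ∃ (L : Fin n → H →L[ℂ] ℂ) (φ : (Fin n → ℂ) → G),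
    @Measurable (Fin n → ℂ) G MeasurableSpace.pi (borel G) φ ∧
    ∀ f, A f = φ (fun i => L i f)

/-- The worst case error of `A` as an approximation of `S`, over the unit ball of `H`. -/
def worstCaseError (S : H →ₗ[ℂ] G) (A : H → G) : ℝ≥0∞ :=
  ⨆ (f : H) (_ : ‖f‖ ≤ 1), ‖S f - A f‖ₑ

/-- The `n`th minimal worst case error. For `n = 0` only the zero algorithm is used, so
that this is the initial error. -/
def minimalError (S : H →ₗ[ℂ] G) (n : ℕ) : ℝ≥0∞ :=
  if n = 0 then worstCaseError S (fun _ => 0)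
  else ⨅ (A : H → G) (_ : IsAlgorithm n A), worstCaseError S A

/-- The absolute and the normalized error criterion. -/
inductive ErrorCriterion
  | ABS
  | NOR

/-- The quantity with which the error demand is scaled: `1` for the absolute criterion, the
initial error for the normalized one. -/
def criterionScale (X : ErrorCriterion) (S : H →ₗ[ℂ] G) : ℝ≥0∞ :=
  match X with
  | .ABS => 1
  | .NOR => minimalError S 0

/-- The numbers `n` of functionals that suffice for an error of at most `ε` (times the scale). -/
def admissibleNumbers (X : ErrorCriterion) (S : H →ₗ[ℂ] G) (ε : ℝ) : Set ℕ :=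
  {n | minimalError S n ≤ ENNReal.ofReal ε * criterionScale X S}

/-- The information complexity: the least admissible number. -/
def infoComplexity (X : ErrorCriterion) (S : H →ₗ[ℂ] G) (ε : ℝ) : ℕ :=
  sInf (admissibleNumbers X S ε)

end WorstCase

/-! ### Tractability notions

`N d ε` is the information complexity of the `d`-variate problem, with `d ≥ 1`, `0 < ε < 1`. -/

/-- The bound of strong polynomial tractability with exponent `p`. -/
def SPTBound (N : ℕ → ℝ → ℕ) (p : ℝ) : Prop :=
  ∃ C : ℝ, 0 ≤ C ∧ ∀ d : ℕ, 1 ≤ d → ∀ ε : ℝ, 0 < ε → ε < 1 → (N d ε : ℝ) ≤ C * ε⁻¹ ^ p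

/-- Strong polynomial tractability. -/
def SPT (N : ℕ → ℝ → ℕ) : Prop :=
  ∃ p : ℝ, 0 ≤ p ∧ SPTBound N p

/-- The exponent of strong polynomial tractability. -/
def sptExponent (N : ℕ → ℝ → ℕ) : ℝ≥0∞ :=
  ⨅ (p : ℝ) (_ : 0 ≤ p ∧ SPTBound N p), ENNReal.ofReal p

/-- Polynomial tractability. -/
def PT (N : ℕ → ℝ → ℕ) : Prop :=
  ∃ C p q : ℝ, 0 ≤ C ∧ 0 ≤ p ∧ 0 ≤ q ∧
    ∀ d : ℕ, 1 ≤ d → ∀ ε : ℝ, 0 < ε → ε < 1 → (N d ε : ℝ) ≤ C * (d : ℝ) ^ q * ε⁻¹ ^ p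

/-- The bound of quasi-polynomial tractability with exponent `t`. -/
def QPTBound (N : ℕ → ℝ → ℕ) (t : ℝ) : Prop :=
  ∃ C : ℝ, 0 < C ∧ ∀ d : ℕ, 1 ≤ d → ∀ ε : ℝ, 0 < ε → ε < 1 →
    (N d ε : ℝ) ≤ C * Real.exp (t * (1 + Real.log d) * (1 + Real.log ε⁻¹))

/-- Quasi-polynomial tractability. -/
def QPT (N : ℕ → ℝ → ℕ) : Prop :=
  ∃ t : ℝ, 0 < t ∧ QPTBound N t

/-- The exponent of quasi-polynomial tractability. -/
def qptExponent (N : ℕ → ℝ → ℕ) : ℝ≥0∞ :=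
  ⨅ (t : ℝ) (_ : 0 < t ∧ QPTBound N t), ENNReal.ofReal t

/-- The limiting process `ε⁻¹ + d → ∞` over all pairs `(d, ε)` with `d ≥ 1` and `0 < ε < 1`. -/
def tractabilityFilter : Filter (ℕ × ℝ) :=
  comap (fun x : ℕ × ℝ => x.2⁻¹ + (x.1 : ℝ)) atTop ⊓ 𝓟 {x | 1 ≤ x.1 ∧ 0 < x.2 ∧ x.2 < 1}

/-- `(s, t)`-weak tractability. -/
def STWT (s t : ℝ) (N : ℕ → ℝ → ℕ) : Prop :=
  Tendsto (fun x : ℕ × ℝ => Real.log (N x.1 x.2) / (x.2⁻¹ ^ s + (x.1 : ℝ) ^ t))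
    tractabilityFilter (𝓝 0)

/-- Uniform weak tractability. -/
def UWT (N : ℕ → ℝ → ℕ) : Prop :=
  ∀ α β : ℝ, 0 < α → 0 < β →
    Tendsto (fun x : ℕ × ℝ => Real.log (N x.1 x.2) / (x.2⁻¹ ^ α + (x.1 : ℝ) ^ β))
      tractabilityFilter (𝓝 0)

/-- Weak tractability. -/
def WT (N : ℕ → ℝ → ℕ) : Prop :=
  Tendsto (fun x : ℕ × ℝ => Real.log (N x.1 x.2) / (x.2⁻¹ + (x.1 : ℝ)))
    tractabilityFilter (𝓝 0)

/-- The curse of dimensionality. -/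
def CurseOfDimensionality (N : ℕ → ℝ → ℕ) : Prop :=
  ∃ C ε₀ a : ℝ, 0 < C ∧ 0 < ε₀ ∧ 0 < a ∧
    ∃ᶠ d : ℕ in atTop, ∀ ε : ℝ, 0 < ε → ε ≤ ε₀ → C * (1 + a) ^ d ≤ (N d ε : ℝ)

/-! ### Fourier coefficients on the unit cube -/

/-- The complex Hilbert space `L₂([0,1]^d)`, with respect to Lebesgue measure. -/
abbrev L2Cube (d : ℕ) : Type := Lp ℂ 2 (volume : Measure (Fin d → I))

/-- The exponential `x ↦ exp (-2πi h·x)` on the unit cube. -/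
def expNeg {d : ℕ} (h : Fin d → ℤ) (x : Fin d → I) : ℂ :=
  Complex.exp (-(2 * Real.pi * Complex.I * ∑ j, (h j : ℂ) * ((x j : ℝ) : ℂ)))

/-- The Fourier coefficient `∫ exp (-2πi h·x) f(x) dx` over the unit cube. -/
def fourierCoefficient {d : ℕ} (f : L2Cube d) (h : Fin d → ℤ) : ℂ :=
  ∫ x, expNeg h x * f x

theorem continuous_expNeg {d : ℕ} (h : Fin d → ℤ) : Continuous (expNeg h) := by
  unfold expNeg
  fun_prop

theorem norm_expNeg {d : ℕ} (h : Fin d → ℤ) (x : Fin d → I) : ‖expNeg h x‖ = 1 := by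
  have : -(2 * (Real.pi : ℂ) * Complex.I * ∑ j, (h j : ℂ) * ((x j : ℝ) : ℂ))
      = ((-(2 * Real.pi * ∑ j, (h j : ℝ) * (x j : ℝ)) : ℝ) : ℂ) * Complex.I := by
    push_cast; ring
  rw [expNeg, this, Complex.norm_exp_ofReal_mul_I]

theorem integrable_expNeg_mul {d : ℕ} (f : L2Cube d) (h : Fin d → ℤ) :
    Integrable (fun x => expNeg h x * f x) := by
  refine Integrable.bdd_mul (c := 1) ((Lp.memLp f).integrable (by norm_num))
    (continuous_expNeg h).aestronglyMeasurable ?_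
  exact ae_of_all _ fun x => (norm_expNeg h x).le

theorem fourierCoefficient_add {d : ℕ} (f g : L2Cube d) (h : Fin d → ℤ) :
    fourierCoefficient (f + g) h = fourierCoefficient f h + fourierCoefficient g h := by
  unfold fourierCoefficient
  rw [← integral_add (integrable_expNeg_mul f h) (integrable_expNeg_mul g h)]
  refine integral_congr_ae ?_
  filter_upwards [Lp.coeFn_add f g] with x hx
  rw [hx, Pi.add_apply, mul_add]

theorem fourierCoefficient_smul {d : ℕ} (c : ℂ) (f : L2Cube d) (h : Fin d → ℤ) :
    fourierCoefficient (c • f) h = c * fourierCoefficient f h := by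
  unfold fourierCoefficient
  rw [← integral_const_mul]
  refine integral_congr_ae ?_
  filter_upwards [Lp.coeFn_smul c f] with x hx
  rw [hx, Pi.smul_apply, smul_eq_mul]
  ring

/-- The circle is cut open to the unit interval. -/
def circleToInterval (y : UnitAddCircle) : I :=
  ⟨(AddCircle.equivIoc 1 0 y).1, by
    have h := (AddCircle.equivIoc 1 0 y).2
    exact ⟨h.1.le, h.2.trans (zero_add _).le⟩⟩

theorem coe_circleToInterval (y : UnitAddCircle) :
    (((circleToInterval y : I) : ℝ) : UnitAddCircle) = y :=
  (AddCircle.equivIoc 1 0).symm_apply_apply y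

theorem measurePreserving_circleToInterval :
    MeasurePreserving circleToInterval
      (AddCircle.haarAddCircle : Measure UnitAddCircle) volume := by
  have hm : Measurable circleToInterval :=
    (measurable_subtype_coe.comp (AddCircle.measurableEquivIoc 1 0).measurable).subtype_mk
  refine ⟨hm, ?_⟩
  have hv : (AddCircle.haarAddCircle : Measure UnitAddCircle) = volume := by
    rw [AddCircle.volume_eq_smul_haarAddCircle]; simp
  have h1 : Measure.map Subtype.val (Measure.map circleToInterval
      (AddCircle.haarAddCircle : Measure UnitAddCircle))
      = Measure.map Subtype.val (volume : Measure I) := by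
    rw [Measure.map_map measurable_subtype_coe hm, unitInterval.measurePreserving_coe.map_eq, hv]
    have h2 := (AddCircle.measurePreserving_equivIoc (T := (1 : ℝ)) (a := 0))
    have h3 : (Subtype.val ∘ circleToInterval : UnitAddCircle → ℝ)
        = Subtype.val ∘ (AddCircle.equivIoc (1 : ℝ) 0) := rfl
    rw [h3, ← Measure.map_map measurable_subtype_coe h2.measurable, h2.map_eq,
      map_comap_subtype_coe measurableSet_Ioc, zero_add]
    exact restrict_Ioc_eq_restrict_Icc
  have h4 := congrArg (Measure.comap (Subtype.val : I → ℝ)) h1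
  rwa [unitInterval.measurableEmbedding_coe.comap_map,
    unitInterval.measurableEmbedding_coe.comap_map] at h4

/-- The torus is cut open to the unit cube. -/
def torusToCube {d : ℕ} (y : UnitAddTorus (Fin d)) : Fin d → I :=
  fun j => circleToInterval (y j)

theorem measurePreserving_torusToCube {d : ℕ} :
    MeasurePreserving (torusToCube (d := d))
      (Measure.pi fun _ : Fin d => (AddCircle.haarAddCircle : Measure UnitAddCircle)) volume :=
  measurePreserving_pi _ _ fun _ => measurePreserving_circleToInterval

theorem expNeg_torusToCube {d : ℕ} (h : Fin d → ℤ) (y : UnitAddTorus (Fin d)) :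
    expNeg h (torusToCube y) = UnitAddTorus.mFourier (-h) y := by
  have : UnitAddTorus.mFourier (-h) y = ∏ j, fourier ((-h) j) (y j) := rfl
  rw [this, expNeg, Finset.mul_sum, ← Finset.sum_neg_distrib, Complex.exp_sum]
  refine Finset.prod_congr rfl fun j _ => ?_
  conv_rhs => rw [← coe_circleToInterval (y j), fourier_coe_apply]
  congr 1
  simp [torusToCube]
  ring

/-- Parseval's identity on the unit cube. -/
theorem hasSum_sq_fourierCoefficient {d : ℕ} (f : L2Cube d) :
    HasSum (fun h => ‖fourierCoefficient f h‖ ^ 2) (‖f‖ ^ 2) := by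
  have mp := measurePreserving_torusToCube (d := d)
  have h2 : ∀ h, UnitAddTorus.mFourierCoeff (Lp.compMeasurePreserving torusToCube mp f) h
      = fourierCoefficient f h := by
    intro h
    have hm : Measure.map torusToCube (Measure.pi fun _ : Fin d =>
        (AddCircle.haarAddCircle : Measure UnitAddCircle)) = volume := mp.map_eq
    have h3 : fourierCoefficient f h = ∫ y, expNeg h (torusToCube y) * f (torusToCube y)
        ∂(Measure.pi fun _ : Fin d => (AddCircle.haarAddCircle : Measure UnitAddCircle)) := by
      have h4 := integral_map (μ := Measure.pi fun _ : Fin d =>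
        (AddCircle.haarAddCircle : Measure UnitAddCircle)) mp.measurable.aemeasurable
        (f := fun x => expNeg h x * f x)
        (by rw [hm]; exact (integrable_expNeg_mul f h).aestronglyMeasurable)
      rw [hm] at h4
      exact h4
    rw [h3]
    refine integral_congr_ae ?_
    filter_upwards [Lp.coeFn_compMeasurePreserving f mp] with y hy
    rw [hy, expNeg_torusToCube, smul_eq_mul, Function.comp_apply]
  have h5 := lp.hasSum_norm (p := 2) (by norm_num)
    (UnitAddTorus.mFourierBasis.repr (Lp.compMeasurePreserving torusToCube mp f))
  rw [LinearIsometryEquiv.norm_map] at h5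
  simp only [UnitAddTorus.mFourierBasis_repr, h2] at h5
  have h6 : ‖Lp.compMeasurePreserving torusToCube mp f‖ = ‖f‖ :=
    Lp.norm_compMeasurePreserving f mp
  have h7 : (2 : ℝ≥0∞).toReal = ((2 : ℕ) : ℝ) := by norm_num
  simp only [h7, Real.rpow_natCast] at h5
  rw [← h6]
  exact h5

theorem eq_zero_of_fourierCoefficient_eq_zero {d : ℕ} (f : L2Cube d)
    (hf : ∀ h, fourierCoefficient f h = 0) : f = 0 := by
  have h1 := hasSum_sq_fourierCoefficient f
  simp only [hf, norm_zero, ne_eq, OfNat.ofNat_ne_zero, not_false_eq_true, zero_pow] at h1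
  have h2 := h1.unique hasSum_zero
  simpa using h2

/-! ### Weighted Korobov spaces

Sequences are indexed from `0`: the entries `r 0`, `g 0` belong to the first variable. -/

/-- The weight of the frequency `h`: the product over the variables of `1` if `h j = 0`
and of `(g j)⁻¹ * |h j| ^ (2 * r j)` otherwise. -/
def korobovWeight (d : ℕ) (r g : ℕ → ℝ) (h : Fin d → ℤ) : ℝ :=
  ∏ j : Fin d, if h j = 0 then 1 else (g j)⁻¹ * |(h j : ℝ)| ^ (2 * r j)

theorem korobovWeight_pos {d : ℕ} {r g : ℕ → ℝ} (hg : ∀ k, 0 < g k) (h : Fin d → ℤ) :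
    0 < korobovWeight d r g h := by
  refine Finset.prod_pos fun j _ => ?_
  split_ifs with hj
  · exact one_pos
  · have : (0 : ℝ) < |(h j : ℝ)| := abs_pos.mpr (by exact_mod_cast hj)
    have := hg j
    positivity

/-- The functions in `L₂([0,1]^d)` for which the weighted sum of the squared Fourier coefficients
is finite. -/
def korobovSubmodule (d : ℕ) (r g : ℕ → ℝ) (hg : ∀ k, 0 < g k) : Submodule ℂ (L2Cube d) where
  carrier := {f | Summable fun h => korobovWeight d r g h * ‖fourierCoefficient f h‖ ^ 2}
  add_mem' := by
    intro f₁ f₂ h₁ h₂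
    refine Summable.of_nonneg_of_le
      (fun h => mul_nonneg (korobovWeight_pos hg h).le (sq_nonneg _)) (fun h => ?_)
      ((h₁.add h₂).mul_left 2)
    have hw := (korobovWeight_pos (r := r) hg h).le
    rw [fourierCoefficient_add, ← mul_add, mul_left_comm]
    refine mul_le_mul_of_nonneg_left ?_ hw
    have h3 := norm_add_le (fourierCoefficient f₁ h) (fourierCoefficient f₂ h)
    nlinarith [norm_nonneg (fourierCoefficient f₁ h + fourierCoefficient f₂ h),
      sq_nonneg (‖fourierCoefficient f₁ h‖ - ‖fourierCoefficient f₂ h‖)]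
  zero_mem' := by
    have h0 : ∀ h, fourierCoefficient (0 : L2Cube d) h = 0 := fun h => by
      simpa using fourierCoefficient_smul 0 (0 : L2Cube d) h
    simp [h0, summable_zero]
  smul_mem' := by
    intro c f hf
    have := hf.mul_left (‖c‖ ^ 2)
    refine this.congr fun h => ?_
    rw [fourierCoefficient_smul, norm_mul]
    ring

/-- The weighted Korobov space on `[0,1]^d`. Its norm is not the one of `L₂([0,1]^d)`. -/
def KorobovSpace (d : ℕ) (r g : ℕ → ℝ) (hg : ∀ k, 0 < g k) : Type :=
  korobovSubmodule d r g hg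

namespace KorobovSpace

variable {d : ℕ} {r g : ℕ → ℝ} {hg : ∀ k, 0 < g k}

instance : AddCommGroup (KorobovSpace d r g hg) :=
  inferInstanceAs (AddCommGroup (korobovSubmodule d r g hg))

instance : Module ℂ (KorobovSpace d r g hg) :=
  inferInstanceAs (Module ℂ (korobovSubmodule d r g hg))

/-- The underlying element of `L₂([0,1]^d)`, as a linear map. -/
def toL2 : KorobovSpace d r g hg →ₗ[ℂ] L2Cube d :=
  (korobovSubmodule d r g hg).subtype

theorem toL2_injective : Function.Injective (toL2 : KorobovSpace d r g hg → L2Cube d) :=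
  Subtype.val_injective

theorem summable (f : KorobovSpace d r g hg) :
    Summable fun h => korobovWeight d r g h * ‖fourierCoefficient (toL2 f) h‖ ^ 2 :=
  f.2

/-- The weighted Fourier coefficients of `f`, a square summable family. -/
def weightedCoefficients :
    KorobovSpace d r g hg →ₗ[ℂ] lp (fun _ : Fin d → ℤ => ℂ) 2 where
  toFun f := ⟨fun h => (√(korobovWeight d r g h) : ℂ) * fourierCoefficient (toL2 f) h, by
    refine memℓp_gen ((summable f).congr fun h => ?_)
    rw [norm_mul, Complex.norm_real, Real.norm_of_nonneg (Real.sqrt_nonneg _)]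
    simp [mul_pow, Real.sq_sqrt (korobovWeight_pos hg h).le]⟩
  map_add' f₁ f₂ := by
    ext h
    rw [lp.coeFn_add, Pi.add_apply]
    simp [fourierCoefficient_add, mul_add]
  map_smul' c f := by
    ext h
    simp [fourierCoefficient_smul]
    ring

theorem weightedCoefficients_injective :
    Function.Injective (weightedCoefficients (d := d) (r := r) (g := g) (hg := hg)) := by
  rw [injective_iff_map_eq_zero]
  intro f hf
  apply toL2_injective
  rw [map_zero]
  refine eq_zero_of_fourierCoefficient_eq_zero _ fun h => ?_
  have h1 : (√(korobovWeight d r g h) : ℂ) * fourierCoefficient (toL2 f) h = 0 :=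
    congrFun (congrArg Subtype.val hf) h
  rcases mul_eq_zero.mp h1 with h2 | h2
  · have := Real.sqrt_pos.mpr (korobovWeight_pos (r := r) hg h)
    rw [Complex.ofReal_eq_zero] at h2
    exact absurd h2 this.ne'
  · exact h2

instance : NormedAddCommGroup (KorobovSpace d r g hg) :=
  NormedAddCommGroup.induced _ _ weightedCoefficients weightedCoefficients_injective

instance : InnerProductSpace ℂ (KorobovSpace d r g hg) where
  norm_smul_le c f := by
    change ‖weightedCoefficients (c • f)‖ ≤ ‖c‖ * ‖weightedCoefficients f‖
    rw [map_smul]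
    exact norm_smul_le _ _
  inner f₁ f₂ := inner ℂ (weightedCoefficients f₁) (weightedCoefficients f₂)
  norm_sq_eq_re_inner f := norm_sq_eq_re_inner (weightedCoefficients f)
  conj_inner_symm f₁ f₂ := inner_conj_symm (weightedCoefficients f₁) (weightedCoefficients f₂)
  add_left f₁ f₂ f₃ := by
    change inner ℂ (weightedCoefficients (f₁ + f₂)) _ = _
    rw [map_add, inner_add_left]
  smul_left f₁ f₂ c := by
    change inner ℂ (weightedCoefficients (c • f₁)) _ = _
    rw [map_smul, inner_smul_left]

/-- The inner product of the Korobov space (linear in the second argument) is the weighted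
inner product of Fourier coefficients. -/
theorem inner_eq_tsum (f₁ f₂ : KorobovSpace d r g hg) :
    inner ℂ f₁ f₂ = ∑' h, (korobovWeight d r g h : ℂ) *
      (fourierCoefficient (toL2 f₂) h * starRingEnd ℂ (fourierCoefficient (toL2 f₁) h)) := by
  change inner ℂ (weightedCoefficients f₁) (weightedCoefficients f₂) = _
  rw [lp.inner_eq_tsum]
  refine tsum_congr fun h => ?_
  have h1 : ((√(korobovWeight d r g h) : ℝ) : ℂ) * (√(korobovWeight d r g h) : ℝ)
      = (korobovWeight d r g h : ℝ) := by
    rw [← Complex.ofReal_mul, Real.mul_self_sqrt (korobovWeight_pos hg h).le]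
  simp only [weightedCoefficients, LinearMap.coe_mk, AddHom.coe_mk, RCLike.inner_apply, map_mul,
    Complex.conj_ofReal]
  rw [← h1]
  ring

/-- The squared norm of the Korobov space. -/
theorem norm_sq_eq_tsum (f : KorobovSpace d r g hg) :
    ‖f‖ ^ 2 = ∑' h, korobovWeight d r g h * ‖fourierCoefficient (toL2 f) h‖ ^ 2 := by
  have h1 : (‖f‖ ^ 2 : ℝ) = RCLike.re (inner ℂ f f) := norm_sq_eq_re_inner f
  have h2 : inner ℂ f f = ((∑' h, korobovWeight d r g h *
      ‖fourierCoefficient (toL2 f) h‖ ^ 2 : ℝ) : ℂ) := by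
    rw [inner_eq_tsum, Complex.ofReal_tsum]
    refine tsum_congr fun h => ?_
    rw [Complex.mul_conj']
    push_cast
    rfl
  rw [h1, h2]
  exact Complex.ofReal_re _

end KorobovSpace

/-- The `d`-variate approximation problem: the embedding of the Korobov space
into `L₂([0,1]^d)`. -/
def APP (r g : ℕ → ℝ) (hg : ∀ k, 0 < g k) (d : ℕ) : KorobovSpace d r g hg →ₗ[ℂ] L2Cube d :=
  KorobovSpace.toL2

/-- The information complexity of the approximation problems. -/
def appComplexity (X : ErrorCriterion) (r g : ℕ → ℝ) (hg : ∀ k, 0 < g k) (d : ℕ) (ε : ℝ) : ℕ :=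
  infoComplexity X (APP r g hg d) ε

end Tractability

end

/-!
The embedding `APP_d` is diagonal in the Fourier basis with the singular values `ρ(h) ^ (-1/2)`.
The partial Fourier sum over a finite set `S` of frequencies is therefore an algorithm with `#S`
functionals whose error is governed by the least weight outside `S`
(`worstCaseError_fourierSum_le`). Conversely, fewer than `#S` functionals vanish simultaneously on
some nonzero trigonometric polynomial `f` with frequencies in `S`, and an algorithm that cannot
tell `f` from `-f` errs by at least `‖f‖` on one of them (`le_worstCaseError_of_isAlgorithm`). Hence
the information complexity is the number of frequencies with `ρ(h) < ε ^ (-2)`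
(`appComplexity_eq_ncard`). The initial error is `1`, so the two error criteria agree. All the
rest is about this counting function, `IsFrequencyCount`.

For upper bounds, `ρ` is a product over the variables, so that `∑ ρ(h) ^ (-τ)` factors and the count
is at most `ε ^ (-2τ) * exp (Z * ∑_{j < d} g j ^ τ)` with a zeta sum `Z`, finite as soon as
`2 τ r 0 > 1` (`IsFrequencyCount.le`). With `τ = p / 2` fixed and `∑ g k ^ (p / 2)` convergent this
is strong polynomial tractability (`IsFrequencyCount.sptBound`). With `τ = t (1 + log d) / 2`, the
terms with `g j < exp (-2 / t)` are at most `1 / d`, which gives quasi-polynomial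
tractability (`IsFrequencyCount.qptBound`).

For lower bounds, the univariate frequencies `1, …, k` force exponents to be at least `1 / r 0`
(`IsFrequencyCount.one_div_le`). The `d.choose m` frequencies with `m` entries `1` and all others
`0` have weight at most `g (d - 1) ^ (-m)`. Letting `d → ∞` for fixed `m` turns a polynomial bound
into decay of the weights (`IsFrequencyCount.ofReal_le_liminf`), and a quasi-polynomial bound into
`t ≥ 2 / B` once `m → ∞` as well (`IsFrequencyCount.two_le_mul`). If all weights are `1`, the
`2 ^ d` frequencies with entries `0` and `1` all have weight `1`, which excludes weak tractability
and is the curse of dimensionality (`IsFrequencyCount.two_pow_le`).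
-/

noncomputable section

namespace Tractability

/-! ### Trigonometric polynomials in the Korobov space -/

theorem expNeg_add {d : ℕ} (h k : Fin d → ℤ) (x : Fin d → I) :
    expNeg (h + k) x = expNeg h x * expNeg k x := by
  unfold expNeg
  rw [← Complex.exp_add]
  congr 1
  simp only [Pi.add_apply, Int.cast_add, add_mul, Finset.sum_add_distrib]
  ring

theorem expNeg_zero {d : ℕ} (x : Fin d → I) : expNeg 0 x = 1 := by
  simp [expNeg]

theorem integral_expNeg {d : ℕ} (h : Fin d → ℤ) :
    ∫ x, expNeg h x = if h = 0 then 1 else 0 := by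
  split_ifs with h0
  · simp [h0, expNeg_zero]
  have mp := measurePreserving_torusToCube (d := d)
  have h1 : ∫ x, expNeg h x = ∫ y, UnitAddTorus.mFourier (-h) y
      ∂(Measure.pi fun _ : Fin d => (AddCircle.haarAddCircle : Measure UnitAddCircle)) := by
    rw [← mp.map_eq, integral_map mp.measurable.aemeasurable
      (continuous_expNeg h).aestronglyMeasurable]
    simp_rw [expNeg_torusToCube]
  have h2 := orthonormal_iff_ite.mp (UnitAddTorus.orthonormal_mFourier (d := Fin d)) h 0
  rw [if_neg h0, ContinuousMap.inner_toLp] at h2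
  rw [h1, ← h2]
  refine integral_congr_ae (ae_of_all _ fun y => ?_)
  simp [UnitAddTorus.mFourier_zero, UnitAddTorus.mFourier_neg]

/-- The exponential `x ↦ exp (2πi k·x)` as an element of `L₂([0,1]^d)`. -/
def expLp {d : ℕ} (k : Fin d → ℤ) : L2Cube d :=
  MemLp.toLp (expNeg (-k)) (MemLp.of_bound (continuous_expNeg _).aestronglyMeasurable 1
    (ae_of_all _ fun x => (norm_expNeg _ x).le))

theorem fourierCoefficient_expLp {d : ℕ} (k h : Fin d → ℤ) :
    fourierCoefficient (expLp k) h = if h = k then 1 else 0 := by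
  have h1 : fourierCoefficient (expLp k) h = ∫ x, expNeg (h + -k) x := by
    refine integral_congr_ae ?_
    filter_upwards [MemLp.coeFn_toLp (MemLp.of_bound (p := 2) (μ := volume)
      (continuous_expNeg (-k)).aestronglyMeasurable 1
      (ae_of_all _ fun x => (norm_expNeg _ x).le))] with x hx
    rw [expNeg_add]
    congr 1
  rw [h1, integral_expNeg]
  simp only [add_neg_eq_zero]

/-- The Fourier coefficient at `h`, as a linear functional on `L₂([0,1]^d)`. -/
def fourierCoefficientₗ {d : ℕ} (h : Fin d → ℤ) : L2Cube d →ₗ[ℂ] ℂ where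
  toFun f := fourierCoefficient f h
  map_add' f g := fourierCoefficient_add f g h
  map_smul' c f := fourierCoefficient_smul c f h

/-- The trigonometric polynomial with the coefficients `c` at the frequencies in `S`. -/
def trigPoly {d : ℕ} (S : Finset (Fin d → ℤ)) : (S → ℂ) →ₗ[ℂ] L2Cube d :=
  Fintype.linearCombination ℂ fun h : S => expLp h.1

theorem fourierCoefficient_trigPoly {d : ℕ} (S : Finset (Fin d → ℤ)) (c : S → ℂ)
    (h : Fin d → ℤ) :
    fourierCoefficient (trigPoly S c) h = if hh : h ∈ S then c ⟨h, hh⟩ else 0 := by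
  change fourierCoefficientₗ h (trigPoly S c) = _
  rw [trigPoly, Fintype.linearCombination_apply, map_sum]
  simp only [map_smul, smul_eq_mul]
  change ∑ k : S, c k * fourierCoefficient (expLp k.1) h = _
  simp only [fourierCoefficient_expLp]
  split_ifs with hh
  · rw [Finset.sum_eq_single ⟨h, hh⟩]
    · simp
    · intro b _ hb
      rw [if_neg (fun e => hb (Subtype.ext e.symm)), mul_zero]
    · simp
  · refine Finset.sum_eq_zero fun k _ => ?_
    rw [if_neg (fun e : h = k.1 => hh (e ▸ k.2)), mul_zero]

theorem one_le_korobovWeight {d : ℕ} {r g : ℕ → ℝ} (hg : ∀ k, 0 < g k) (hg1 : ∀ k, g k ≤ 1)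
    (hr : ∀ k, 0 < r k) (h : Fin d → ℤ) : 1 ≤ korobovWeight d r g h := by
  refine Finset.prod_induction _ (fun x : ℝ => 1 ≤ x)
    (fun _ _ => one_le_mul_of_one_le_of_one_le) le_rfl fun j _ => ?_
  split_ifs with hj
  · exact le_rfl
  · have h1 : (1 : ℝ) ≤ |(h j : ℝ)| := by exact_mod_cast Int.one_le_abs hj
    have h2 : (1 : ℝ) ≤ |(h j : ℝ)| ^ (2 * r j) :=
      Real.one_le_rpow h1 (mul_nonneg zero_le_two (hr j).le)
    exact one_le_mul_of_one_le_of_one_le ((one_le_inv₀ (hg j)).mpr (hg1 j)) h2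

theorem korobovWeight_zero {d : ℕ} (r g : ℕ → ℝ) : korobovWeight d r g 0 = 1 := by
  simp [korobovWeight]

namespace KorobovSpace

variable {d : ℕ} {r g : ℕ → ℝ} {hg : ∀ k, 0 < g k}

/-- Trigonometric polynomials as elements of the Korobov space. -/
def ofTrigPoly (hg : ∀ k, 0 < g k) (r : ℕ → ℝ) (S : Finset (Fin d → ℤ)) :
    (S → ℂ) →ₗ[ℂ] KorobovSpace d r g hg :=
  (trigPoly S).codRestrict (korobovSubmodule d r g hg) fun c => by
    refine summable_of_hasFiniteSupport (S.finite_toSet.subset fun h hh => ?_)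
    by_contra hS
    refine hh ?_
    dsimp only
    rw [fourierCoefficient_trigPoly, dif_neg (by simpa using hS)]
    simp

theorem toL2_ofTrigPoly (S : Finset (Fin d → ℤ)) (c : S → ℂ) :
    toL2 (ofTrigPoly hg r S c) = trigPoly S c :=
  rfl

theorem weight_mul_sq_le (f : KorobovSpace d r g hg) (h : Fin d → ℤ) :
    korobovWeight d r g h * ‖fourierCoefficient (toL2 f) h‖ ^ 2 ≤ ‖f‖ ^ 2 := by
  rw [norm_sq_eq_tsum]
  exact (summable f).le_tsum h
    fun k _ => mul_nonneg (korobovWeight_pos hg k).le (sq_nonneg _)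

/-- The Fourier coefficient at `h`, as a continuous linear functional on the Korobov space. -/
def coeffCLM (h : Fin d → ℤ) : KorobovSpace d r g hg →L[ℂ] ℂ :=
  LinearMap.mkContinuous ((fourierCoefficientₗ h).comp toL2)
    (√(korobovWeight d r g h))⁻¹ fun f => by
      have hw := korobovWeight_pos (r := r) hg h
      change ‖fourierCoefficient (toL2 f) h‖ ≤ _
      rw [inv_mul_eq_div, le_div_iff₀ (Real.sqrt_pos.mpr hw)]
      refine le_of_sq_le_sq ?_ (norm_nonneg f)
      rw [mul_pow, Real.sq_sqrt hw.le, mul_comm]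
      exact weight_mul_sq_le f h

theorem coeffCLM_apply (h : Fin d → ℤ) (f : KorobovSpace d r g hg) :
    coeffCLM h f = fourierCoefficient (toL2 f) h :=
  rfl

/-- The partial Fourier sum over the frequencies in `S`. -/
def fourierSum (S : Finset (Fin d → ℤ)) (f : KorobovSpace d r g hg) : L2Cube d :=
  trigPoly S fun h => fourierCoefficient (toL2 f) h.1

end KorobovSpace

open KorobovSpace

variable {d : ℕ} {r g : ℕ → ℝ} {hg : ∀ k, 0 < g k}

theorem isAlgorithm_fourierSum (S : Finset (Fin d → ℤ)) :
    IsAlgorithm S.card (fourierSum S : KorobovSpace d r g hg → L2Cube d) := by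
  refine ⟨fun i => coeffCLM (S.equivFin.symm i).1,
    fun y => trigPoly S fun h => y (S.equivFin h), ?_, fun f => ?_⟩
  · borelize (L2Cube d)
    refine Continuous.measurable ?_
    exact ((trigPoly S).comp (LinearMap.funLeft ℂ ℂ S.equivFin)).continuous_of_finiteDimensional
  · simp only [coeffCLM_apply, Equiv.symm_apply_apply]
    rfl

/-- If all frequencies outside `S` have weight at least `M`, then the partial Fourier sum over `S`
has error at most `M ^ (-1/2)`. -/
theorem worstCaseError_fourierSum_le (S : Finset (Fin d → ℤ)) {M : ℝ} (hM : 0 < M)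
    (hS : ∀ h, h ∉ S → M ≤ korobovWeight d r g h) :
    worstCaseError (APP r g hg d) (fourierSum S) ≤ ENNReal.ofReal (√M)⁻¹ := by
  refine iSup₂_le fun f hf => ?_
  rw [← ofReal_norm]
  refine ENNReal.ofReal_le_ofReal ?_
  set u : L2Cube d := APP r g hg d f - fourierSum S f
  have hu : ∀ h, fourierCoefficient u h
      = if h ∈ S then 0 else fourierCoefficient (toL2 f) h := by
    intro h
    have h1 : fourierCoefficient u h = fourierCoefficient (toL2 f) h
        - fourierCoefficient (fourierSum S f) h := map_sub (fourierCoefficientₗ h) _ _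
    rw [h1, fourierSum, fourierCoefficient_trigPoly]
    split_ifs <;> simp
  have h2 : ‖u‖ ^ 2 ≤ M⁻¹ * ‖f‖ ^ 2 := by
    rw [norm_sq_eq_tsum]
    refine hasSum_le (fun h => ?_) (hasSum_sq_fourierCoefficient u)
      ((summable f).hasSum.mul_left M⁻¹)
    have hw := korobovWeight_pos (r := r) hg h
    rw [hu]
    split_ifs with hh
    · rw [norm_zero, zero_pow two_ne_zero]
      positivity
    · rw [← mul_assoc]
      refine le_mul_of_one_le_left (sq_nonneg _) ?_
      rw [inv_mul_eq_div, one_le_div hM]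
      exact hS h hh
  refine le_of_sq_le_sq ?_ (by positivity)
  rw [inv_pow, Real.sq_sqrt hM.le]
  refine h2.trans (mul_le_of_le_one_right (by positivity) ?_)
  exact pow_le_one₀ (norm_nonneg _) hf

/-- Fewer functionals than there are frequencies of weight at most `M` leave an error of at least
`M ^ (-1/2)`: they vanish on some trigonometric polynomial `f ≠ 0` with these frequencies, and so
do not separate `f` from `-f`. -/
theorem le_worstCaseError_of_isAlgorithm {n : ℕ} {A : KorobovSpace d r g hg → L2Cube d}
    (hA : IsAlgorithm n A) (S : Finset (Fin d → ℤ)) (hn : n < S.card) {M : ℝ} (hM : 0 < M)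
    (hS : ∀ h ∈ S, korobovWeight d r g h ≤ M) :
    ENNReal.ofReal (√M)⁻¹ ≤ worstCaseError (APP r g hg d) A := by
  obtain ⟨L, φ, -, hφ⟩ := hA
  let Φ : (S → ℂ) →ₗ[ℂ] (Fin n → ℂ) :=
    (LinearMap.pi fun i => (L i).toLinearMap).comp (ofTrigPoly hg r S)
  have hker : LinearMap.ker Φ ≠ ⊥ := LinearMap.ker_ne_bot_of_finrank_lt (by simpa using hn)
  obtain ⟨c, hc, hc0⟩ := (Submodule.ne_bot_iff _).mp hker
  set f₀ : KorobovSpace d r g hg := ofTrigPoly hg r S c with hf₀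
  have hL0 : ∀ i, L i f₀ = 0 := fun i => congrFun (LinearMap.mem_ker.mp hc) i
  have hf0 : f₀ ≠ 0 := by
    intro h0
    refine hc0 (funext fun h => ?_)
    have h1 := fourierCoefficient_trigPoly S c h.1
    rw [dif_pos h.2, ← toL2_ofTrigPoly (hg := hg) (r := r), ← hf₀, h0, map_zero] at h1
    exact h1.symm.trans (map_zero (fourierCoefficientₗ h.1))
  -- the Korobov norm is at most `√M` times the `L₂` norm on these polynomials
  have hcmp : ‖f₀‖ ^ 2 ≤ M * ‖toL2 f₀‖ ^ 2 := by
    rw [norm_sq_eq_tsum]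
    refine hasSum_le (fun h => ?_) (summable f₀).hasSum
      ((hasSum_sq_fourierCoefficient (toL2 f₀)).mul_left M)
    by_cases hh : h ∈ S
    · exact mul_le_mul_of_nonneg_right (hS h hh) (sq_nonneg _)
    · rw [hf₀, toL2_ofTrigPoly, fourierCoefficient_trigPoly, dif_neg hh]
      simp
  have hpos : 0 < ‖f₀‖ := norm_pos_iff.mpr hf0
  have hcmp' : ‖f₀‖ ≤ √M * ‖toL2 f₀‖ := by
    refine le_of_sq_le_sq ?_ (by positivity)
    rwa [mul_pow, Real.sq_sqrt hM.le]
  set f : KorobovSpace d r g hg := ((‖f₀‖⁻¹ : ℝ) : ℂ) • f₀ with hf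
  have hLf : ∀ i, L i f = 0 := fun i => by rw [hf, map_smul, hL0, smul_zero]
  have hnf : ‖f‖ ≤ 1 := by
    rw [hf, norm_smul, Complex.norm_real, Real.norm_of_nonneg (by positivity),
      inv_mul_cancel₀ hpos.ne']
  have hlow : (√M)⁻¹ ≤ ‖toL2 f‖ := by
    rw [hf, map_smul, norm_smul, Complex.norm_real, Real.norm_of_nonneg (by positivity),
      inv_mul_eq_div, inv_eq_one_div, div_le_div_iff₀ (Real.sqrt_pos.mpr hM) hpos]
    linarith
  have hA1 : A f = φ 0 := by rw [hφ]; congr 1; funext i; exact hLf i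
  have hA2 : A (-f) = φ 0 := by
    rw [hφ]; congr 1; funext i; rw [map_neg, hLf]; simp
  have e1 : ‖toL2 f - φ 0‖ₑ ≤ worstCaseError (APP r g hg d) A := by
    rw [← hA1]
    exact le_iSup₂ (f := fun (f : KorobovSpace d r g hg) (_ : ‖f‖ ≤ 1) =>
      ‖APP r g hg d f - A f‖ₑ) f hnf
  have e2 : ‖toL2 (-f) - φ 0‖ₑ ≤ worstCaseError (APP r g hg d) A := by
    rw [← hA2]
    exact le_iSup₂ (f := fun (f : KorobovSpace d r g hg) (_ : ‖f‖ ≤ 1) =>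
      ‖APP r g hg d f - A f‖ₑ) (-f) (by rwa [norm_neg])
  have h3 : ‖toL2 f‖ ≤ max ‖toL2 f - φ 0‖ ‖toL2 (-f) - φ 0‖ := by
    have h4 : (2 : ℝ) * ‖toL2 f‖ ≤ ‖toL2 f - φ 0‖ + ‖toL2 (-f) - φ 0‖ := by
      have h5 := norm_sub_le (toL2 f - φ 0) (toL2 (-f) - φ 0)
      have h6 : toL2 f - φ 0 - (toL2 (-f) - φ 0) = (2 : ℂ) • toL2 f := by
        rw [map_neg, two_smul]; abel
      rw [h6, norm_smul] at h5
      simpa using h5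
    rcases le_total ‖toL2 f - φ 0‖ ‖toL2 (-f) - φ 0‖ with h | h
    · rw [max_eq_right h]; linarith
    · rw [max_eq_left h]; linarith
  refine (ENNReal.ofReal_le_ofReal (hlow.trans h3)).trans ?_
  rcases le_total ‖toL2 f - φ 0‖ ‖toL2 (-f) - φ 0‖ with h | h
  · rwa [max_eq_right h, ofReal_norm]
  · rwa [max_eq_left h, ofReal_norm]

theorem isAlgorithm_zero : IsAlgorithm 0 (fun _ : KorobovSpace d r g hg => (0 : L2Cube d)) :=
  ⟨fun i => i.elim0, fun _ => 0, @measurable_const _ _ (borel _) _ _, fun _ => rfl⟩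

/-- The initial error is `1`, since the smallest weight is that of the zero frequency. -/
theorem minimalError_zero (hg1 : ∀ k, g k ≤ 1) (hr : ∀ k, 0 < r k) :
    minimalError (APP r g hg d) 0 = 1 := by
  rw [minimalError, if_pos rfl]
  apply le_antisymm
  · have h1 := worstCaseError_fourierSum_le (hg := hg) (r := r) (d := d) ∅ one_pos
      (fun h _ => one_le_korobovWeight hg hg1 hr h)
    have h2 : (fourierSum ∅ : KorobovSpace d r g hg → L2Cube d) = fun _ => 0 := by
      funext f
      simp [fourierSum, trigPoly, Fintype.linearCombination_apply]
    rw [h2] at h1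
    simpa using h1
  · have h1 := le_worstCaseError_of_isAlgorithm (isAlgorithm_zero (hg := hg) (r := r) (d := d))
      {0} (by simp) one_pos (fun h hh => by
        rw [Finset.mem_singleton.mp hh, korobovWeight_zero])
    simpa using h1

theorem criterionScale_APP (X : ErrorCriterion) (hg1 : ∀ k, g k ≤ 1) (hr : ∀ k, 0 < r k) :
    criterionScale X (APP r g hg d) = 1 := by
  cases X
  · rfl
  · exact minimalError_zero hg1 hr

/-- The frequencies of weight less than `M`. -/
def lowFrequencies (d : ℕ) (r g : ℕ → ℝ) (M : ℝ) : Set (Fin d → ℤ) :=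
  {h | korobovWeight d r g h < M}

/-- `ε` is an admissible error for exactly those numbers of functionals that are at least the
number of frequencies of weight less than `ε ^ (-2)`. -/
theorem admissibleNumbers_APP (X : ErrorCriterion) (hg1 : ∀ k, g k ≤ 1) (hr : ∀ k, 0 < r k)
    {ε : ℝ} (hε : 0 < ε) (hε1 : ε < 1) (hfin : (lowFrequencies d r g (ε⁻¹ ^ 2)).Finite) :
    admissibleNumbers X (APP r g hg d) ε = Set.Ici (lowFrequencies d r g (ε⁻¹ ^ 2)).ncard := by
  set S := hfin.toFinset
  have hSmem : ∀ h, h ∈ S ↔ korobovWeight d r g h < ε⁻¹ ^ 2 := fun h => hfin.mem_toFinset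
  have hε2 : 1 < ε⁻¹ ^ 2 := one_lt_pow₀ ((one_lt_inv₀ hε).mpr hε1) two_ne_zero
  have h0 : (0 : Fin d → ℤ) ∈ S := by rwa [hSmem, korobovWeight_zero]
  rw [Set.ncard_eq_toFinset_card _ hfin, show hfin.toFinset = S from rfl]
  ext n
  simp only [admissibleNumbers, Set.mem_ofPred_eq, Set.mem_Ici, criterionScale_APP X hg1 hr,
    mul_one]
  constructor
  · intro hle
    by_contra! hn
    obtain ⟨k, hk, hmax⟩ := S.exists_max_image (korobovWeight d r g) ⟨0, h0⟩
    have hkpos := korobovWeight_pos (r := r) hg k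
    have hlt : ENNReal.ofReal ε < ENNReal.ofReal (√(korobovWeight d r g k))⁻¹ := by
      rw [ENNReal.ofReal_lt_ofReal_iff (by positivity), lt_inv_comm₀ hε (Real.sqrt_pos.mpr hkpos)]
      exact (Real.sqrt_lt' (by positivity)).mpr ((hSmem k).mp hk)
    refine absurd (hle.trans_lt hlt) (not_lt.mpr ?_)
    unfold minimalError
    split_ifs with hn0
    · subst hn0
      exact le_worstCaseError_of_isAlgorithm isAlgorithm_zero S hn hkpos hmax
    · exact le_iInf₂ fun A hA => le_worstCaseError_of_isAlgorithm hA S hn hkpos hmax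
  · intro hn
    have hS0 : 0 < S.card := Finset.card_pos.mpr ⟨0, h0⟩
    rw [minimalError, if_neg (by omega)]
    -- further functionals may be ignored
    obtain ⟨L, φ, hφm, hφ⟩ := isAlgorithm_fourierSum (hg := hg) (r := r) S
    let L' : Fin n → KorobovSpace d r g hg →L[ℂ] ℂ := fun i =>
      if hi : i.1 < S.card then L ⟨i.1, hi⟩ else 0
    have hA : IsAlgorithm n (fourierSum S : KorobovSpace d r g hg → L2Cube d) := by
      refine ⟨L', fun y => φ fun i => y (Fin.castLE hn i),
        hφm.comp (measurable_pi_lambda _ fun i => measurable_pi_apply _), fun f => ?_⟩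
      rw [hφ]
      congr 1
      funext i
      simp [L', i.2]
    refine (iInf₂_le _ hA).trans ?_
    refine (worstCaseError_fourierSum_le S (M := ε⁻¹ ^ 2) (by positivity)
      fun h hh => not_lt.mp fun hlt => hh ((hSmem h).mpr hlt)).trans ?_
    rw [Real.sqrt_sq (by positivity), inv_inv]

theorem appComplexity_eq_ncard (X : ErrorCriterion) (hg1 : ∀ k, g k ≤ 1) (hr : ∀ k, 0 < r k)
    {ε : ℝ} (hε : 0 < ε) (hε1 : ε < 1) (hfin : (lowFrequencies d r g (ε⁻¹ ^ 2)).Finite) :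
    appComplexity X r g hg d ε = (lowFrequencies d r g (ε⁻¹ ^ 2)).ncard := by
  rw [appComplexity, infoComplexity, admissibleNumbers_APP X hg1 hr hε hε1 hfin]
  exact csInf_Ici

/-! ### Counting the frequencies of small weight -/

/-- The zeta sum `∑ |n| ^ (-b)` over the nonzero integers; for `b ≠ 0` the term at `n = 0`
vanishes. -/
def zetaInt (b : ℝ) : ℝ := ∑' n : ℤ, |(n : ℝ)| ^ (-b)

theorem zetaInt_nonneg (b : ℝ) : 0 ≤ zetaInt b :=
  tsum_nonneg fun _ => by positivity

/-- The sum `∑ ρ(h) ^ (-τ)` over all frequencies factors into one zeta sum for each variable, and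
each frequency of weight less than `M` contributes at least `M ^ (-τ)`. -/
theorem card_le_of_korobovWeight_lt {d : ℕ} {r g : ℕ → ℝ} (hg : ∀ k, 0 < g k)
    {τ b M : ℝ} (hM : 0 ≤ M) (hτ : 0 ≤ τ) (hb : 1 < b) (hbr : ∀ j, b ≤ 2 * r j * τ)
    (T : Finset (Fin d → ℤ)) (hT : ∀ h ∈ T, korobovWeight d r g h < M) :
    (T.card : ℝ) ≤ M ^ τ * Real.exp (zetaInt b * ∑ j ∈ Finset.range d, g j ^ τ) := by
  set u : ℕ → ℤ → ℝ := fun j n => if n = 0 then 1 else g j ^ τ * |(n : ℝ)| ^ (-b) with hu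
  have hu0 : ∀ j n, 0 ≤ u j n := fun j n => by
    have := hg j
    simp only [hu]
    split_ifs <;> positivity
  have hterm : ∀ h ∈ T, 1 ≤ M ^ τ * ∏ j : Fin d, u j (h j) := by
    intro h hh
    have h1 : 1 ≤ korobovWeight d r g h ^ τ * ∏ j : Fin d, u j (h j) := by
      rw [korobovWeight, ← Real.finsetProd_rpow _ _ fun j _ => ?_, ← Finset.prod_mul_distrib]
      · refine Finset.prod_induction _ (fun x : ℝ => 1 ≤ x)
          (fun _ _ => one_le_mul_of_one_le_of_one_le) le_rfl fun j _ => ?_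
        by_cases hj : h j = 0
        · simp [hu, hj]
        · have hgj := hg j
          have hn : (1 : ℝ) ≤ |(h j : ℝ)| := by exact_mod_cast Int.one_le_abs hj
          have hn0 : (0 : ℝ) < |(h j : ℝ)| := one_pos.trans_le hn
          simp only [hu, if_neg hj]
          rw [Real.mul_rpow (by positivity) (by positivity), Real.inv_rpow hgj.le,
            ← Real.rpow_mul hn0.le, mul_mul_mul_comm, inv_mul_cancel₀ (by positivity), one_mul,
            ← Real.rpow_add hn0]
          exact Real.one_le_rpow hn (by linarith [hbr j])
      · have := hg j
        split_ifs <;> positivity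
    refine h1.trans (mul_le_mul_of_nonneg_right ?_ (Finset.prod_nonneg fun j _ => hu0 _ _))
    exact Real.rpow_le_rpow (korobovWeight_pos hg h).le (hT h hh).le hτ
  have hsum : ∀ (j : ℕ) (F : Finset ℤ), ∑ n ∈ F, u j n ≤ 1 + zetaInt b * g j ^ τ := by
    intro j F
    have hgj := hg j
    have h1 : ∀ n ∈ F, u j n ≤ (if n = 0 then 1 else 0) + g j ^ τ * |(n : ℝ)| ^ (-b) := by
      intro n _
      simp only [hu]
      split_ifs
      · exact le_add_of_nonneg_right (by positivity)
      · rw [zero_add]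
    refine (Finset.sum_le_sum h1).trans ?_
    rw [Finset.sum_add_distrib, ← Finset.mul_sum, mul_comm (zetaInt b)]
    refine add_le_add ?_ (mul_le_mul_of_nonneg_left ?_ (by positivity))
    · rw [Finset.sum_ite_eq']
      split_ifs <;> norm_num
    · exact (Real.summable_abs_int_rpow hb).sum_le_tsum F fun _ _ => by positivity
  calc (T.card : ℝ) = ∑ _h ∈ T, (1 : ℝ) := by simp
    _ ≤ ∑ h ∈ T, M ^ τ * ∏ j : Fin d, u j (h j) := Finset.sum_le_sum hterm
    _ = M ^ τ * ∑ h ∈ T, ∏ j : Fin d, u j (h j) := by rw [Finset.mul_sum]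
    _ ≤ M ^ τ * ∑ h ∈ Fintype.piFinset (fun j : Fin d => T.image (· j)),
          ∏ j : Fin d, u j (h j) := by
        refine mul_le_mul_of_nonneg_left (Finset.sum_le_sum_of_subset_of_nonneg
          (fun h hh => ?_) fun h _ _ => Finset.prod_nonneg fun j _ => hu0 _ _) (by positivity)
        exact Fintype.mem_piFinset.mpr fun j => Finset.mem_image_of_mem (· j) hh
    _ = M ^ τ * ∏ j : Fin d, ∑ n ∈ T.image (· j), u j n := by
        rw [Finset.prod_univ_sum]
    _ ≤ M ^ τ * ∏ j : Fin d, (1 + zetaInt b * g j ^ τ) := by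
        refine mul_le_mul_of_nonneg_left (Finset.prod_le_prod
          (fun j _ => Finset.sum_nonneg fun n _ => hu0 _ _) fun j _ => hsum _ _) (by positivity)
    _ ≤ M ^ τ * Real.exp (zetaInt b * ∑ j ∈ Finset.range d, g j ^ τ) := by
        refine mul_le_mul_of_nonneg_left ?_ (by positivity)
        rw [Finset.mul_sum, ← Fin.sum_univ_eq_sum_range (fun j => zetaInt b * g j ^ τ)]
        refine Real.prod_one_add_le_exp_sum _ fun j => ?_
        have := hg j
        have := zetaInt_nonneg b
        positivity

theorem lowFrequencies_finite {d : ℕ} {r g : ℕ → ℝ} (hg : ∀ k, 0 < g k) (hr0 : 0 < r 0)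
    (hr : Monotone r) {M : ℝ} (hM : 0 ≤ M) : (lowFrequencies d r g M).Finite := by
  by_contra hinf
  set K := M ^ (1 / r 0) * Real.exp (zetaInt 2 * ∑ j ∈ Finset.range d, g j ^ (1 / r 0))
  obtain ⟨n, hn⟩ := exists_nat_gt K
  obtain ⟨T, hT, hcard⟩ := Set.Infinite.exists_subset_card_eq hinf n
  have h1 := card_le_of_korobovWeight_lt hg hM (τ := 1 / r 0) (b := 2) (by positivity)
    one_lt_two (fun j => ?_) T fun h hh => hT hh
  · rw [hcard] at h1
    exact absurd h1 (not_le.mpr hn)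
  · rw [mul_one_div, le_div_iff₀ hr0]
    linarith [hr (Nat.zero_le j)]

/-- `N d ε` is the number of `d`-variate frequencies of weight less than `ε ^ (-2)`, which is what
the information complexity of the approximation problem amounts to. -/
def IsFrequencyCount (r g : ℕ → ℝ) (N : ℕ → ℝ → ℕ) : Prop :=
  ∀ d ε, 0 < ε → ε < 1 → N d ε = (lowFrequencies d r g (ε⁻¹ ^ 2)).ncard

section Count

variable {r g : ℕ → ℝ} {N : ℕ → ℝ → ℕ}

theorem IsFrequencyCount.le (hN : IsFrequencyCount r g N) (hg : ∀ k, 0 < g k) (hr0 : 0 < r 0)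
    (hr : Monotone r) {τ b : ℝ} (hb : 1 < b) (hbr : b ≤ 2 * r 0 * τ) {d : ℕ} {ε : ℝ}
    (hε : 0 < ε) (hε1 : ε < 1) :
    (N d ε : ℝ) ≤
      ε⁻¹ ^ (2 * τ) * Real.exp (zetaInt b * ∑ j ∈ Finset.range d, g j ^ τ) := by
  have hfin := lowFrequencies_finite (d := d) hg hr0 hr (sq_nonneg ε⁻¹)
  have hτ : 0 ≤ τ := by
    by_contra! h
    nlinarith
  rw [hN d ε hε hε1, Set.ncard_eq_toFinset_card _ hfin]
  refine (card_le_of_korobovWeight_lt hg (sq_nonneg _) hτ hb (fun j => ?_) hfin.toFinset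
    fun h hh => hfin.mem_toFinset.mp hh).trans_eq ?_
  · refine hbr.trans (mul_le_mul_of_nonneg_right ?_ hτ)
    linarith [hr (Nat.zero_le j)]
  · rw [Real.rpow_mul (by positivity), Real.rpow_two]

theorem IsFrequencyCount.card_le (hN : IsFrequencyCount r g N) (hg : ∀ k, 0 < g k)
    (hr0 : 0 < r 0) (hr : Monotone r) {d : ℕ} {ε : ℝ} (hε : 0 < ε) (hε1 : ε < 1)
    (T : Finset (Fin d → ℤ)) (hT : ∀ h ∈ T, korobovWeight d r g h < ε⁻¹ ^ 2) :
    T.card ≤ N d ε := by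
  have hfin := lowFrequencies_finite (d := d) hg hr0 hr (sq_nonneg ε⁻¹)
  rw [hN d ε hε hε1, Set.ncard_eq_toFinset_card _ hfin]
  exact Finset.card_le_card fun h hh => hfin.mem_toFinset.mpr (hT h hh)

/-- The frequency that is `1` on `s` and `0` elsewhere. -/
def indicatorFrequency {d : ℕ} (s : Finset (Fin d)) (j : Fin d) : ℤ := if j ∈ s then 1 else 0

theorem indicatorFrequency_injective {d : ℕ} :
    Function.Injective (indicatorFrequency (d := d)) := by
  intro s t h
  ext j
  have := congrFun h j
  simp only [indicatorFrequency] at this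
  split_ifs at this <;> simp_all

theorem korobovWeight_indicatorFrequency {d : ℕ} (s : Finset (Fin d)) :
    korobovWeight d r g (indicatorFrequency s) = ∏ j ∈ s, (g j)⁻¹ := by
  rw [korobovWeight, ← Finset.prod_subset (Finset.subset_univ s)]
  · refine Finset.prod_congr rfl fun j hj => ?_
    simp [indicatorFrequency, hj]
  · intro j _ hj
    simp [indicatorFrequency, hj]

/-- The frequencies with `m` entries `1` and all others `0` are counted if no weight `g j` is below
`v` and `v ^ (-m) < ε ^ (-2)`. -/
theorem IsFrequencyCount.choose_le (hN : IsFrequencyCount r g N) (hg : ∀ k, 0 < g k)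
    (hr0 : 0 < r 0) (hr : Monotone r) {d m : ℕ} {ε v : ℝ} (hε : 0 < ε) (hε1 : ε < 1)
    (hv : 0 < v) (hgv : ∀ j < d, v ≤ g j) (hvε : v⁻¹ ^ m < ε⁻¹ ^ 2) :
    d.choose m ≤ N d ε := by
  have h1 := hN.card_le hg hr0 hr hε hε1
    (((Finset.univ : Finset (Fin d)).powersetCard m).map ⟨_, indicatorFrequency_injective⟩)
    fun h hh => by
      obtain ⟨s, hs, rfl⟩ := Finset.mem_map.mp hh
      rw [Finset.mem_powersetCard_univ] at hs
      refine lt_of_le_of_lt ?_ hvε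
      rw [Function.Embedding.coeFn_mk, korobovWeight_indicatorFrequency, ← hs,
        ← Finset.prod_const]
      exact Finset.prod_le_prod (fun j _ => (inv_pos.mpr (hg j)).le)
        fun j _ => inv_anti₀ hv (hgv j j.2)
  simpa using h1

theorem IsFrequencyCount.two_pow_le (hN : IsFrequencyCount r g N) (hr0 : 0 < r 0)
    (hr : Monotone r) (hg1 : ∀ k, g k = 1) {d : ℕ} {ε : ℝ} (hε : 0 < ε) (hε1 : ε < 1) :
    2 ^ d ≤ N d ε := by
  have h1 := hN.card_le (fun k => by simp [hg1]) hr0 hr hε hε1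
    ((Finset.univ : Finset (Finset (Fin d))).map ⟨_, indicatorFrequency_injective⟩)
    fun h hh => by
      obtain ⟨s, -, rfl⟩ := Finset.mem_map.mp hh
      rw [Function.Embedding.coeFn_mk, korobovWeight_indicatorFrequency]
      simpa [hg1] using one_lt_pow₀ ((one_lt_inv₀ hε).mpr hε1) two_ne_zero
  simpa using h1

/-- Univariate frequencies `1, …, k`. -/
theorem IsFrequencyCount.le_one (hN : IsFrequencyCount r g N) (hg : ∀ k, 0 < g k)
    (hr0 : 0 < r 0) (hr : Monotone r) {k : ℕ} {ε : ℝ} (hε : 0 < ε) (hε1 : ε < 1)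
    (hk : (g 0)⁻¹ * (k : ℝ) ^ (2 * r 0) < ε⁻¹ ^ 2) : k ≤ N 1 ε := by
  have hinj : Function.Injective fun (i : ℕ) (_ : Fin 1) => (i : ℤ) :=
    fun i j h => by simpa using congrFun h 0
  have h1 := hN.card_le hg hr0 hr hε hε1 ((Finset.Icc 1 k).map ⟨_, hinj⟩) fun h hh => by
    obtain ⟨i, hi, rfl⟩ := Finset.mem_map.mp hh
    rw [Finset.mem_Icc] at hi
    refine lt_of_le_of_lt ?_ hk
    have hi0 : i ≠ 0 := by omega
    have := hg 0
    simp only [korobovWeight, Function.Embedding.coeFn_mk, Finset.univ_unique,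
      Finset.prod_singleton, Nat.cast_eq_zero, hi0, if_false, Int.cast_natCast, Nat.abs_cast,
      Fin.default_eq_zero, Fin.val_zero]
    refine mul_le_mul_of_nonneg_left ?_ (by positivity)
    exact Real.rpow_le_rpow (by positivity) (by exact_mod_cast hi.2) (by positivity)
  simpa using h1

end Count

/-! ### Auxiliary estimates -/

theorem exponent_le_of_eventually_rpow_le {a b C : ℝ}
    (h : ∀ᶠ n : ℕ in atTop, (n : ℝ) ^ a ≤ C * (n : ℝ) ^ b) : a ≤ b := by
  by_contra! hab
  have h1 : Tendsto (fun n : ℕ => (n : ℝ) ^ (a - b)) atTop atTop :=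
    (tendsto_rpow_atTop (sub_pos.mpr hab)).comp tendsto_natCast_atTop_atTop
  obtain ⟨n, hn, hn1, hn0⟩ := (h.and ((h1.eventually_gt_atTop C).and
    (eventually_gt_atTop 0))).exists
  have hn0' : (0 : ℝ) < n := by exact_mod_cast hn0
  rw [Real.rpow_sub hn0', lt_div_iff₀ (by positivity)] at hn1
  exact absurd hn (not_le.mpr hn1)

theorem exists_mul_pow_le_choose (m : ℕ) :
    ∃ c : ℝ, 0 < c ∧ ∀ d : ℕ, 2 * m ≤ d → c * (d : ℝ) ^ m ≤ (d.choose m : ℝ) := by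
  refine ⟨(2 ^ m * (m.factorial : ℝ))⁻¹, by positivity, fun d hd => ?_⟩
  refine le_trans ?_ (Nat.pow_le_choose m d)
  have h1 : (d : ℝ) / 2 ≤ ((d + 1 - m : ℕ) : ℝ) := by
    rw [Nat.cast_sub (by omega)]
    have : (2 * m : ℝ) ≤ d := by exact_mod_cast hd
    push_cast
    linarith
  have h2 : ((d : ℝ) / 2) ^ m ≤ ((d + 1 - m : ℕ) : ℝ) ^ m :=
    pow_le_pow_left₀ (by positivity) h1 m
  rw [le_div_iff₀ (by positivity)]
  refine le_trans (le_of_eq ?_) h2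
  rw [div_pow]
  field_simp

/-- An infimum of exponents whose set is bracketed by the thresholds `L` and `c` is `max L c`. -/
theorem iInf_exponent_eq_max {R : ℝ → Prop} {L : ℝ≥0∞} {c : ℝ}
    (hle : ∀ p, R p → c ≤ p ∧ L ≤ ENNReal.ofReal p)
    (hlt : ∀ p, c < p → L < ENNReal.ofReal p → R p) :
    ⨅ (p : ℝ) (_ : R p), ENNReal.ofReal p = max L (ENNReal.ofReal c) := by
  apply le_antisymm
  · refine le_of_forall_gt_imp_ge_of_dense fun x hx => ?_
    obtain ⟨y, hy, hyx⟩ := ENNReal.lt_iff_exists_nnreal_btwn.mp hx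
    rw [← ENNReal.ofReal_coe_nnreal] at hy hyx
    obtain ⟨h1, h2⟩ := max_lt_iff.mp hy
    exact (iInf₂_le (y : ℝ) (hlt _ (ENNReal.ofReal_lt_ofReal_iff'.mp h2).1 h1)).trans hyx.le
  · exact le_iInf₂ fun p hp =>
      max_le (hle p hp).2 (ENNReal.ofReal_le_ofReal (hle p hp).1)

theorem two_div_le_ofReal {L : ℝ≥0∞} {p : ℝ} (hp : 0 < p) (h : ENNReal.ofReal (2 / p) ≤ L) :
    2 / L ≤ ENNReal.ofReal p := by
  refine ENNReal.div_le_of_le_mul ?_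
  calc (2 : ℝ≥0∞) = ENNReal.ofReal p * ENNReal.ofReal (2 / p) := by
        rw [← ENNReal.ofReal_mul hp.le, mul_div_cancel₀ _ hp.ne']; simp
    _ ≤ _ := mul_le_mul_right h _

theorem ofReal_two_div_lt {L : ℝ≥0∞} {p : ℝ} (hp : 0 < p) (h : 2 / L < ENNReal.ofReal p) :
    ENNReal.ofReal (2 / p) < L := by
  have hL0 : L ≠ 0 := by
    rintro rfl
    rw [ENNReal.div_zero two_ne_zero] at h
    exact not_top_lt h
  rw [ENNReal.div_lt_iff (Or.inl hL0) (Or.inr (by simp))] at h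
  rw [ENNReal.ofReal_div_of_pos hp, ENNReal.div_lt_iff (Or.inl (by simpa using hp))
    (Or.inl ENNReal.ofReal_ne_top), mul_comm]
  simpa using h

theorem exists_error_of_one_lt {Q : ℝ} (hQ : 1 < Q) :
    ∃ ε : ℝ, 0 < ε ∧ ε < 1 ∧ ε⁻¹ ^ 2 = Q ∧ (∀ p : ℝ, ε⁻¹ ^ p = Q ^ (p / 2)) ∧
      Real.log ε⁻¹ = Real.log Q / 2 := by
  have h0 : 0 < Q := one_pos.trans hQ
  refine ⟨(√Q)⁻¹, by positivity, ?_, ?_, fun p => ?_, ?_⟩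
  · exact inv_lt_one_of_one_lt₀ (by simpa using Real.sqrt_lt_sqrt zero_le_one hQ)
  · rw [inv_inv, Real.sq_sqrt h0.le]
  · rw [inv_inv, Real.sqrt_eq_rpow, ← Real.rpow_mul h0.le]
    congr 1
    ring
  · rw [inv_inv, Real.log_sqrt h0.le]

section

variable {r g : ℕ → ℝ} {N : ℕ → ℝ → ℕ}

/-- The univariate problem alone forces the exponent `1 / r 0`. -/
theorem IsFrequencyCount.one_div_le (hN : IsFrequencyCount r g N) (hg : ∀ k, 0 < g k)
    (hg1 : g 0 ≤ 1) (hr0 : 0 < r 0) (hr : Monotone r) {C p : ℝ}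
    (h : ∀ ε : ℝ, 0 < ε → ε < 1 → (N 1 ε : ℝ) ≤ C * ε⁻¹ ^ p) : 1 / r 0 ≤ p := by
  have hg0 : 1 ≤ (g 0)⁻¹ := (one_le_inv₀ (hg 0)).mpr hg1
  have h1 : (1 : ℝ) ≤ r 0 * p := by
    refine exponent_le_of_eventually_rpow_le (C := C * (2 * (g 0)⁻¹) ^ (p / 2)) ?_
    filter_upwards [eventually_ge_atTop 1] with k hk
    have hk1 : (1 : ℝ) ≤ k := by exact_mod_cast hk
    have hk2 : (1 : ℝ) ≤ (k : ℝ) ^ (2 * r 0) := Real.one_le_rpow hk1 (by positivity)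
    have hk3 : 1 ≤ (g 0)⁻¹ * (k : ℝ) ^ (2 * r 0) := one_le_mul_of_one_le_of_one_le hg0 hk2
    obtain ⟨ε, hε, hε1, hQ, hp, -⟩ :=
      exists_error_of_one_lt (Q := 2 * ((g 0)⁻¹ * (k : ℝ) ^ (2 * r 0))) (by linarith)
    have h2 := hN.le_one hg hr0 hr hε hε1 (k := k) (by rw [hQ]; linarith)
    have h3 := h ε hε hε1
    rw [hp, ← mul_assoc 2, Real.mul_rpow (by positivity) (by positivity),
      ← Real.rpow_mul (by positivity), ← mul_assoc] at h3
    rw [Real.rpow_one]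
    refine (Nat.cast_le.mpr h2).trans (h3.trans_eq ?_)
    congr 2
    ring
  rwa [div_le_iff₀ hr0, mul_comm]

/-! ### Polynomial tractability -/

/-- A polynomial bound forces a lower bound on the decay of the weights: compare it with the
`(k+1).choose m` frequencies that have `m` entries `1` among the first `k + 1` variables. -/
theorem IsFrequencyCount.ofReal_le_liminf (hN : IsFrequencyCount r g N) (hg : ∀ k, 0 < g k)
    (hg1 : g 0 ≤ 1) (hg_anti : Antitone g) (hr0 : 0 < r 0) (hr : Monotone r) {C p q : ℝ}
    (hp : 0 < p)
    (h : ∀ d : ℕ, 1 ≤ d → ∀ ε : ℝ, 0 < ε → ε < 1 → (N d ε : ℝ) ≤ C * (d : ℝ) ^ q * ε⁻¹ ^ p)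
    {m : ℕ} (hm : 0 < m) :
    ENNReal.ofReal (2 / (m * p) * (m - q)) ≤ liminf
      (fun k : ℕ => ENNReal.ofReal (Real.log (g k)⁻¹ / Real.log ((k : ℝ) + 1))) atTop := by
  obtain ⟨c, hc, hchoose⟩ := exists_mul_pow_le_choose m
  set D := Real.log C - Real.log c + p / 2 * Real.log 2
  have hlog : Tendsto (fun k : ℕ => Real.log ((k : ℝ) + 1)) atTop atTop :=
    Real.tendsto_log_atTop.comp (tendsto_atTop_add_const_right _ _ tendsto_natCast_atTop_atTop)
  have hlim : Tendsto (fun k : ℕ => ENNReal.ofReal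
      (2 / (m * p) * (m - q - D / Real.log ((k : ℝ) + 1)))) atTop
      (𝓝 (ENNReal.ofReal (2 / (m * p) * (m - q)))) := by
    refine ENNReal.tendsto_ofReal (Tendsto.const_mul _ ?_)
    simpa using (tendsto_const_nhds (x := (m : ℝ) - q)).sub (hlog.const_div_atTop D)
  rw [← hlim.liminf_eq]
  refine liminf_le_liminf ?_
  filter_upwards [eventually_ge_atTop (2 * m), hlog.eventually_gt_atTop 0] with k hk hL
  refine ENNReal.ofReal_le_ofReal ?_
  have hgk := hg k
  have hgk1 : 1 ≤ (g k)⁻¹ ^ m :=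
    one_le_pow₀ ((one_le_inv₀ hgk).mpr ((hg_anti (Nat.zero_le k)).trans hg1))
  obtain ⟨ε, hε, hε1, hQ, hpow, -⟩ :=
    exists_error_of_one_lt (Q := 2 * (g k)⁻¹ ^ m) (by linarith)
  have h1 := hN.choose_le hg hr0 hr (d := k + 1) (m := m) hε hε1 hgk
    (fun j hj => hg_anti (by omega)) (by rw [hQ]; linarith)
  have h2 : c * ((k : ℝ) + 1) ^ m ≤ C * (((k : ℝ) + 1) ^ q * (2 * (g k)⁻¹ ^ m) ^ (p / 2)) := by
    have h3 := hchoose (k + 1) (by omega)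
    have h4 := h (k + 1) (by omega) ε hε hε1
    rw [hpow, mul_assoc] at h4
    push_cast at h3 h4
    exact h3.trans ((Nat.cast_le.mpr h1).trans h4)
  have hX : 0 < ((k : ℝ) + 1) ^ q * (2 * (g k)⁻¹ ^ m) ^ (p / 2) := by positivity
  have hC : 0 < C := pos_of_mul_pos_left (lt_of_lt_of_le (by positivity) h2) hX.le
  have h5 := Real.log_le_log (by positivity) h2
  rw [Real.log_mul hc.ne' (by positivity), Real.log_mul hC.ne' hX.ne',
    Real.log_mul (by positivity) (by positivity), Real.log_pow, Real.log_rpow (by positivity),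
    Real.log_rpow (by positivity), Real.log_mul two_ne_zero (by positivity), Real.log_pow] at h5
  rw [div_mul_eq_mul_div, div_le_div_iff₀ (by positivity) hL, mul_assoc, sub_mul,
    div_mul_cancel₀ _ hL.ne']
  simp only [D]
  linarith

/-- Summability of `g k ^ (p / 2)` gives the bound of strong polynomial tractability. -/
theorem IsFrequencyCount.sptBound (hN : IsFrequencyCount r g N) (hg : ∀ k, 0 < g k)
    (hr0 : 0 < r 0) (hr : Monotone r) {p : ℝ} (hp : 1 / r 0 < p)
    (hA : 2 / liminf (fun k : ℕ => ENNReal.ofReal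
      (Real.log (g k)⁻¹ / Real.log ((k : ℝ) + 1))) atTop < ENNReal.ofReal p) :
    SPTBound N p := by
  have hp0 : 0 < p := (by positivity : (0 : ℝ) < 1 / r 0).trans hp
  have h1 := ofReal_two_div_lt hp0 hA
  obtain ⟨a, ha1, ha2⟩ := ENNReal.lt_iff_exists_nnreal_btwn.mp h1
  rw [← ENNReal.ofReal_coe_nnreal] at ha1 ha2
  have ha := (ENNReal.ofReal_lt_ofReal_iff'.mp ha1).1
  have hap : 1 < (a : ℝ) * (p / 2) := by
    rw [div_lt_iff₀ hp0] at ha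
    linarith
  have hev := eventually_lt_of_lt_liminf ha2
  have hsum : Summable fun k : ℕ => g k ^ (p / 2) := by
    have h2 : Summable fun k : ℕ => ((k + 1 : ℕ) : ℝ) ^ (-((a : ℝ) * (p / 2))) :=
      (summable_nat_add_iff (f := fun k : ℕ => (k : ℝ) ^ (-((a : ℝ) * (p / 2)))) 1).mpr
        (Real.summable_nat_rpow.mpr (by linarith))
    refine Summable.of_norm_bounded_eventually_nat h2 ?_
    filter_upwards [hev, eventually_gt_atTop 0] with k hk hk0
    have hgk := hg k
    have hL : 0 < Real.log ((k : ℝ) + 1) := Real.log_pos (by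
      have : (0 : ℝ) < k := by exact_mod_cast hk0
      linarith)
    have h3 := (ENNReal.ofReal_lt_ofReal_iff'.mp hk).1
    rw [lt_div_iff₀ hL, Real.log_inv] at h3
    rw [Real.norm_of_nonneg (by positivity), Real.rpow_def_of_pos hgk,
      Real.rpow_def_of_pos (by positivity), Real.exp_le_exp]
    push_cast
    nlinarith
  refine ⟨Real.exp (zetaInt (p * r 0) * ∑' k, g k ^ (p / 2)), by positivity,
    fun d _ ε hε hε1 => ?_⟩
  have h4 := hN.le hg hr0 hr (τ := p / 2) (b := p * r 0) ((div_lt_iff₀ hr0).mp hp) (by linarith)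
    hε hε1 (d := d)
  rw [mul_div_cancel₀ _ two_ne_zero, mul_comm] at h4
  refine h4.trans (mul_le_mul_of_nonneg_right (Real.exp_le_exp.mpr ?_) (by positivity))
  exact mul_le_mul_of_nonneg_left
    (hsum.sum_le_tsum _ fun k _ => Real.rpow_nonneg (hg k).le _) (zetaInt_nonneg _)

/-! ### Quasi-polynomial tractability -/

/-- If some `g J` is below `exp (-2 / t)`, then with `τ = t (1 + log d) / 2` the sum of the
`g j ^ τ` over the first `d` variables is at most `J + 1`. -/
theorem IsFrequencyCount.qptBound (hN : IsFrequencyCount r g N) (hg : ∀ k, 0 < g k)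
    (hg1 : g 0 ≤ 1) (hg_anti : Antitone g) (hr0 : 0 < r 0) (hr : Monotone r) {t : ℝ}
    (ht : 1 / r 0 < t) {J : ℕ} (hJ : 2 / t < Real.log (g J)⁻¹) : QPTBound N t := by
  have ht0 : 0 < t := (by positivity : (0 : ℝ) < 1 / r 0).trans ht
  set Z := zetaInt (t * r 0)
  have hZ : 0 ≤ Z := zetaInt_nonneg _
  refine ⟨Real.exp (Z * (J + 1)), by positivity, fun d hd ε hε hε1 => ?_⟩
  have hd1 : (1 : ℝ) ≤ d := by exact_mod_cast hd
  have hld : 0 ≤ Real.log d := Real.log_nonneg hd1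
  have hε' : 0 < Real.log ε⁻¹ := Real.log_pos ((one_lt_inv₀ hε).mpr hε1)
  set τ := t / 2 * (1 + Real.log d)
  have hτ : 0 < τ := by positivity
  have htr : 1 < t * r 0 := (div_lt_iff₀ hr0).mp ht
  have h1 := hN.le hg hr0 hr (τ := τ) (b := t * r 0) htr (by
    have : 2 * r 0 * τ = t * r 0 + t * r 0 * Real.log d := by simp only [τ]; ring
    rw [this]
    exact le_add_of_nonneg_right (by positivity)) hε hε1 (d := d)
  have hterm : ∀ j ∈ Finset.range d, g j ^ τ ≤ (if j < J then 1 else 0) + (d : ℝ)⁻¹ := by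
    intro j _
    split_ifs with hjJ
    · have := Real.rpow_le_one (hg j).le ((hg_anti (Nat.zero_le j)).trans hg1) hτ.le
      have : (0 : ℝ) ≤ (d : ℝ)⁻¹ := by positivity
      linarith
    · rw [zero_add]
      refine (Real.rpow_le_rpow (hg j).le (hg_anti (not_lt.mp hjJ)) hτ.le).trans ?_
      rw [← Real.exp_log (show (0 : ℝ) < (d : ℝ)⁻¹ by positivity), Real.log_inv,
        Real.rpow_def_of_pos (hg J), Real.exp_le_exp]
      rw [div_lt_iff₀ ht0, Real.log_inv] at hJ
      have : Real.log (g J) * τ = -(-Real.log (g J) * t) * (1 + Real.log d) / 2 := by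
        simp only [τ]; ring
      nlinarith
  have hsum : ∑ j ∈ Finset.range d, g j ^ τ ≤ J + 1 := by
    refine (Finset.sum_le_sum hterm).trans ?_
    rw [Finset.sum_add_distrib, Finset.sum_const, Finset.card_range, nsmul_eq_mul,
      mul_inv_cancel₀ (by positivity), ← Finset.sum_filter]
    refine add_le_add_left ?_ _
    rw [Finset.sum_const, nsmul_one]
    have : ((Finset.range d).filter (· < J)) ⊆ Finset.range J := fun j hj =>
      Finset.mem_range.mpr (Finset.mem_filter.mp hj).2
    simpa using Finset.card_le_card this
  refine h1.trans ?_
  rw [mul_comm]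
  refine mul_le_mul (Real.exp_le_exp.mpr (mul_le_mul_of_nonneg_left hsum hZ)) ?_
    (by positivity) (by positivity)
  rw [Real.rpow_def_of_pos (by positivity), Real.exp_le_exp]
  simp only [τ]
  nlinarith [mul_nonneg ht0.le hld]

/-- A quasi-polynomial bound with exponent `t` forces `t ≥ 2 / β` when all weights are at least
`exp (-β)`: for fixed `m` the bound grows in `d` with the exponent
`t * (1 + (log 2 + m * β) / 2)`, while `d.choose m` grows with the exponent `m`. -/
theorem IsFrequencyCount.two_le_mul (hN : IsFrequencyCount r g N) (hg : ∀ k, 0 < g k)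
    (hr0 : 0 < r 0) (hr : Monotone r) {t β : ℝ} (hβ : 0 ≤ β)
    (hgβ : ∀ k, Real.log (g k)⁻¹ ≤ β) (h : QPTBound N t) : 2 ≤ t * β := by
  obtain ⟨C, hC, h⟩ := h
  have key : ∀ m : ℕ, (m : ℝ) ≤ t * (1 + (Real.log 2 + m * β) / 2) := by
    intro m
    obtain ⟨c, hc, hchoose⟩ := exists_mul_pow_le_choose m
    set v := Real.exp (-β)
    have hv : 0 < v := Real.exp_pos _
    have hv1 : 1 ≤ v⁻¹ ^ m := one_le_pow₀ ((one_le_inv₀ hv).mpr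
      (Real.exp_le_one_iff.mpr (neg_nonpos.mpr hβ)))
    obtain ⟨ε, hε, hε1, hQ, -, hlog⟩ :=
      exists_error_of_one_lt (Q := 2 * v⁻¹ ^ m) (by linarith)
    have hvβ : Real.log v⁻¹ = β := by rw [Real.log_inv, Real.log_exp, neg_neg]
    rw [Real.log_mul two_ne_zero (by positivity), Real.log_pow, hvβ] at hlog
    set E := t * (1 + (Real.log 2 + m * β) / 2)
    refine exponent_le_of_eventually_rpow_le (C := c⁻¹ * (C * Real.exp E)) ?_
    filter_upwards [eventually_ge_atTop (2 * m), eventually_ge_atTop 1] with d hd hd1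
    have hd0 : (0 : ℝ) < d := by exact_mod_cast hd1
    have h1 := hN.choose_le hg hr0 hr (d := d) (m := m) hε hε1 hv (fun j _ => by
      rw [← Real.exp_log (hg j), Real.exp_le_exp]
      have := hgβ j
      rw [Real.log_inv] at this
      linarith) (by rw [hQ]; linarith)
    have h2 := (hchoose d hd).trans ((Nat.cast_le.mpr h1).trans (h d hd1 ε hε hε1))
    rw [Real.rpow_natCast, mul_assoc, ← div_eq_inv_mul, le_div_iff₀ hc, mul_comm]
    refine h2.trans_eq ?_
    rw [hlog, Real.rpow_def_of_pos hd0, mul_assoc C, ← Real.exp_add]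
    congr 2
    simp only [E]
    ring
  by_contra! hlt
  obtain ⟨m, hm⟩ := exists_nat_gt (t * (1 + Real.log 2 / 2) / (1 - t * β / 2))
  rw [div_lt_iff₀ (by linarith)] at hm
  linarith [key m]

end

/-! ### Weak tractability -/

theorem tendsto_rpow_add_rpow {s t : ℝ} (hs : 0 < s) (ht : 0 < t) :
    Tendsto (fun x : ℕ × ℝ => x.2⁻¹ ^ s + (x.1 : ℝ) ^ t) tractabilityFilter atTop := by
  refine tendsto_atTop.mpr fun b => ?_
  obtain ⟨R, hR0, hRs, hRt⟩ := ((eventually_ge_atTop (0 : ℝ)).and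
    (((tendsto_rpow_atTop hs).eventually_ge_atTop b).and
      ((tendsto_rpow_atTop ht).eventually_ge_atTop b))).exists
  have h1 : ∀ᶠ x : ℕ × ℝ in tractabilityFilter, 2 * R ≤ x.2⁻¹ + (x.1 : ℝ) :=
    (tendsto_comap.eventually_ge_atTop (2 * R)).filter_mono inf_le_left
  have h2 : ∀ᶠ x : ℕ × ℝ in tractabilityFilter, 1 ≤ x.1 ∧ 0 < x.2 ∧ x.2 < 1 :=
    (eventually_principal.mpr fun _ hx => hx).filter_mono inf_le_right
  filter_upwards [h1, h2] with x hx ⟨_, hx2, _⟩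
  have hy : 0 < x.2⁻¹ := inv_pos.mpr hx2
  rcases le_total R x.2⁻¹ with h | h
  · have h3 := Real.rpow_le_rpow hR0 h hs.le
    have : 0 ≤ (x.1 : ℝ) ^ t := by positivity
    linarith
  · have h3 := Real.rpow_le_rpow hR0 (show R ≤ (x.1 : ℝ) by linarith) ht.le
    have : 0 ≤ x.2⁻¹ ^ s := by positivity
    linarith

/-- It suffices to bound `log N` by an arbitrarily small multiple of `ε ^ (-s) + d ^ t`, up to a
constant. -/
theorem stwt_of_forall_log_le {N : ℕ → ℝ → ℕ} {s t : ℝ} (hs : 0 < s) (ht : 0 < t)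
    (h : ∀ δ : ℝ, 0 < δ → ∃ K : ℝ, ∀ d : ℕ, 1 ≤ d → ∀ ε : ℝ, 0 < ε → ε < 1 →
      Real.log (N d ε) ≤ δ * (ε⁻¹ ^ s + (d : ℝ) ^ t) + K) : STWT s t N := by
  have h2 : ∀ᶠ x : ℕ × ℝ in tractabilityFilter, 1 ≤ x.1 ∧ 0 < x.2 ∧ x.2 < 1 :=
    (eventually_principal.mpr fun _ hx => hx).filter_mono inf_le_right
  have hW := tendsto_rpow_add_rpow hs ht
  refine Metric.tendsto_nhds.mpr fun η hη => ?_
  obtain ⟨K, hK⟩ := h (η / 2) (by positivity)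
  filter_upwards [h2, hW.eventually_gt_atTop 0, hW.eventually_gt_atTop (K / (η / 2))]
    with x ⟨hd, hε, hε1⟩ hW0 hWK
  rw [div_lt_iff₀ (by positivity)] at hWK
  rw [Real.dist_eq, sub_zero, abs_of_nonneg (div_nonneg (Real.log_natCast_nonneg _) hW0.le),
    div_lt_iff₀ hW0]
  linarith [hK x.1 hd x.2 hε hε1]

theorem exists_one_add_log_sq_le {s δ : ℝ} (hs : 0 < s) (hδ : 0 < δ) :
    ∃ K : ℝ, ∀ x : ℝ, 1 ≤ x → (1 + Real.log x) ^ 2 ≤ δ * x ^ s + K := by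
  set c := (1 + (s / 4)⁻¹) ^ 2
  refine ⟨c ^ 2 / (4 * δ), fun x hx => ?_⟩
  have hx0 : 0 < x := one_pos.trans_le hx
  have h1 := Real.log_le_rpow_div hx0.le (show 0 < s / 4 by positivity)
  have hz : 1 ≤ x ^ (s / 4) := Real.one_le_rpow hx (by positivity)
  set z := x ^ (s / 4)
  have hzs : x ^ s = z ^ 4 := by
    rw [← Real.rpow_natCast, ← Real.rpow_mul hx0.le]
    congr 1
    push_cast
    ring
  -- `log x ≤ (4 / s) z` with `z = x ^ (s / 4)`, and `c z² ≤ δ z⁴ + c² / (4 δ)`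
  have h2 : (1 + Real.log x) ^ 2 ≤ c * z ^ 2 := by
    rw [← mul_pow]
    refine pow_le_pow_left₀ (by linarith [Real.log_nonneg hx]) ?_ 2
    rw [div_eq_inv_mul] at h1
    linarith
  refine h2.trans ?_
  rw [hzs, ← sub_nonneg]
  have : δ * z ^ 4 + c ^ 2 / (4 * δ) - c * z ^ 2 = (2 * δ * z ^ 2 - c) ^ 2 / (4 * δ) := by
    field_simp
    ring
  rw [this]
  positivity

theorem exists_mul_le_rpow {t δ Z : ℝ} (ht : 1 < t) (hδ : 0 < δ) (hZ : 0 ≤ Z) :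
    ∃ K : ℝ, ∀ x : ℝ, 1 ≤ x → Z * x ≤ δ * x ^ t + K := by
  set R := (Z / δ) ^ (t - 1)⁻¹
  have hR : 0 ≤ R := by positivity
  refine ⟨Z * R, fun x hx => ?_⟩
  have hx0 : 0 < x := one_pos.trans_le hx
  rcases le_total x R with h | h
  · have := mul_le_mul_of_nonneg_left h hZ
    have : 0 ≤ δ * x ^ t := by positivity
    linarith
  · have h1 : Z / δ ≤ x ^ (t - 1) := by
      have h2 := Real.rpow_le_rpow hR h (sub_pos.mpr ht).le
      rwa [← Real.rpow_mul (by positivity), inv_mul_cancel₀ (sub_pos.mpr ht).ne',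
        Real.rpow_one] at h2
    rw [div_le_iff₀ hδ] at h1
    have h3 : x ^ t = x ^ (t - 1) * x := by
      rw [← Real.rpow_add_one hx0.ne', sub_add_cancel]
    have h4 := mul_le_mul_of_nonneg_right h1 hx0.le
    have : 0 ≤ Z * R := by positivity
    rw [h3]
    linarith

section

variable {r g : ℕ → ℝ} {N : ℕ → ℝ → ℕ}

theorem IsFrequencyCount.one_le (hN : IsFrequencyCount r g N) (hg : ∀ k, 0 < g k)
    (hr0 : 0 < r 0) (hr : Monotone r) {d : ℕ} {ε : ℝ} (hε : 0 < ε) (hε1 : ε < 1) :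
    1 ≤ N d ε := by
  have h1 := hN.card_le hg hr0 hr (d := d) hε hε1 {0} fun h hh => by
    rw [Finset.mem_singleton.mp hh, korobovWeight_zero]
    exact one_lt_pow₀ ((one_lt_inv₀ hε).mpr hε1) two_ne_zero
  simpa using h1

/-- The exponent `t (1 + log d) (1 + log ε⁻¹)` is split by the arithmetic-geometric mean
inequality. -/
theorem IsFrequencyCount.stwt_of_qpt (hN : IsFrequencyCount r g N) (hg : ∀ k, 0 < g k)
    (hr0 : 0 < r 0) (hr : Monotone r) (h : QPT N) {s t : ℝ} (hs : 0 < s) (ht : 0 < t) :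
    STWT s t N := by
  obtain ⟨p, hp, C, hC, h⟩ := h
  refine stwt_of_forall_log_le hs ht fun δ hδ => ?_
  obtain ⟨K₁, hK₁⟩ := exists_one_add_log_sq_le hs (show 0 < 2 * δ / p by positivity)
  obtain ⟨K₂, hK₂⟩ := exists_one_add_log_sq_le ht (show 0 < 2 * δ / p by positivity)
  refine ⟨Real.log C + p / 2 * (K₁ + K₂), fun d hd ε hε hε1 => ?_⟩
  have hN1 : (0 : ℝ) < N d ε := by exact_mod_cast hN.one_le hg hr0 hr hε hε1
  have h1 := Real.log_le_log hN1 (h d hd ε hε hε1)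
  rw [Real.log_mul hC.ne' (Real.exp_ne_zero _), Real.log_exp] at h1
  have h2 := hK₁ ε⁻¹ ((one_lt_inv₀ hε).mpr hε1).le
  have h3 := hK₂ d (by exact_mod_cast hd)
  have h4 := mul_le_mul_of_nonneg_left
    (two_mul_le_add_sq (1 + Real.log d) (1 + Real.log ε⁻¹)) (show 0 ≤ p / 2 by positivity)
  have h5 := mul_le_mul_of_nonneg_left (add_le_add h3 h2) (show 0 ≤ p / 2 by positivity)
  have h6 : p / 2 * (2 * δ / p * (d : ℝ) ^ t + K₂ + (2 * δ / p * ε⁻¹ ^ s + K₁))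
      = δ * (ε⁻¹ ^ s + (d : ℝ) ^ t) + p / 2 * (K₁ + K₂) := by
    field_simp
    ring
  linarith

theorem IsFrequencyCount.stwt_of_one_lt (hN : IsFrequencyCount r g N) (hg : ∀ k, 0 < g k)
    (hg1 : ∀ k, g k ≤ 1) (hr0 : 0 < r 0) (hr : Monotone r) {s t : ℝ} (hs : 0 < s) (ht : 1 < t) :
    STWT s t N := by
  refine stwt_of_forall_log_le hs (one_pos.trans ht) fun δ hδ => ?_
  obtain ⟨K₁, hK₁⟩ := exists_one_add_log_sq_le hs (show 0 < δ * r 0 / 2 by positivity)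
  obtain ⟨K₂, hK₂⟩ := exists_mul_le_rpow ht hδ (zetaInt_nonneg 2)
  refine ⟨2 / r 0 * K₁ + K₂, fun d hd ε hε hε1 => ?_⟩
  have hN1 : (0 : ℝ) < N d ε := by exact_mod_cast hN.one_le hg hr0 hr hε hε1
  have h0 := hN.le hg hr0 hr (τ := 1 / r 0) one_lt_two
    (by rw [mul_one_div, mul_div_assoc, div_self hr0.ne', mul_one]) hε hε1 (d := d)
  have h1 := Real.log_le_log hN1 h0
  rw [Real.log_mul (by positivity) (Real.exp_ne_zero _), Real.log_exp,
    Real.log_rpow (by positivity)] at h1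
  have hsum : ∑ j ∈ Finset.range d, g j ^ (1 / r 0) ≤ d := by
    refine (Finset.sum_le_sum fun j _ => Real.rpow_le_one (hg j).le (hg1 j)
      (by positivity)).trans ?_
    simp
  have h2 := mul_le_mul_of_nonneg_left hsum (zetaInt_nonneg 2)
  have h3 := hK₂ d (by exact_mod_cast hd)
  have hε' : 1 ≤ ε⁻¹ := ((one_lt_inv₀ hε).mpr hε1).le
  have h4 : Real.log ε⁻¹ ≤ δ * r 0 / 2 * ε⁻¹ ^ s + K₁ := by
    have := Real.log_nonneg hε'
    nlinarith [hK₁ ε⁻¹ hε']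
  have h5 := mul_le_mul_of_nonneg_left h4 (show 0 ≤ 2 / r 0 by positivity)
  have h6 : 2 / r 0 * (δ * r 0 / 2 * ε⁻¹ ^ s + K₁) = δ * ε⁻¹ ^ s + 2 / r 0 * K₁ := by
    field_simp
  rw [mul_one_div] at h1
  linarith

/-- For constant weights `N d (1/2) ≥ 2 ^ d`, so that already `d ↦ (d, 1/2)` violates weak
tractability. -/
theorem IsFrequencyCount.not_stwt (hN : IsFrequencyCount r g N) (hr0 : 0 < r 0) (hr : Monotone r)
    (hg1 : ∀ k, g k = 1) {s t : ℝ} (ht : t ≤ 1) : ¬ STWT s t N := by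
  intro h
  have hseq : Tendsto (fun d : ℕ => (d, (1 / 2 : ℝ))) atTop tractabilityFilter := by
    refine tendsto_inf.mpr ⟨tendsto_comap_iff.mpr ?_, tendsto_principal.mpr ?_⟩
    · exact tendsto_atTop_add_const_left atTop (1 / 2 : ℝ)⁻¹ tendsto_natCast_atTop_atTop
    · filter_upwards [eventually_ge_atTop 1] with d hd
      exact ⟨hd, by norm_num, by norm_num⟩
  have hlog2 : 0 < Real.log 2 := Real.log_pos one_lt_two
  have hbig : ∀ᶠ d : ℕ in atTop, (1 / 2 : ℝ)⁻¹ ^ s ≤ d :=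
    tendsto_natCast_atTop_atTop.eventually_ge_atTop _
  obtain ⟨d, hd1, hd2, hd3⟩ := (((h.comp hseq).eventually_lt_const
    (half_pos hlog2)).and ((eventually_ge_atTop 1).and hbig)).exists
  have hd0 : (1 : ℝ) ≤ d := by exact_mod_cast hd2
  simp only [Function.comp_apply] at hd1
  rw [div_lt_iff₀ (by positivity)] at hd1
  have h1 : (d : ℝ) * Real.log 2 ≤ Real.log (N d (1 / 2)) := by
    rw [← Real.log_pow]
    refine Real.log_le_log (by positivity) ?_
    exact_mod_cast hN.two_pow_le hr0 hr hg1 (d := d) (ε := 1 / 2) (by norm_num) (by norm_num)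
  have h2 : (d : ℝ) ^ t ≤ d := by
    simpa using Real.rpow_le_rpow_of_exponent_le hd0 ht
  nlinarith

theorem IsFrequencyCount.curse (hN : IsFrequencyCount r g N) (hr0 : 0 < r 0) (hr : Monotone r)
    (hg1 : ∀ k, g k = 1) : CurseOfDimensionality N := by
  refine ⟨1, 1 / 2, 1, one_pos, by norm_num, one_pos, Frequently.of_forall fun d ε hε hε1 => ?_⟩
  have := hN.two_pow_le hr0 hr hg1 (d := d) hε (by linarith)
  rw [one_mul, one_add_one_eq_two]
  exact_mod_cast this

/-! ### Tractability and exponents in terms of the weights -/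

theorem exists_exponent_gt {L : ℝ≥0∞} (hL : L ≠ ⊤) (c : ℝ) :
    ∃ p : ℝ, c < p ∧ L < ENNReal.ofReal p := by
  refine ⟨max c L.toReal + 1, by linarith [le_max_left c L.toReal], ?_⟩
  rw [ENNReal.lt_ofReal_iff_toReal_lt hL]
  linarith [le_max_right c L.toReal]

theorem QPTBound.univariate {p : ℝ} (h : QPTBound N p) :
    ∃ C : ℝ, ∀ ε : ℝ, 0 < ε → ε < 1 → (N 1 ε : ℝ) ≤ C * ε⁻¹ ^ p := by
  obtain ⟨C, -, h⟩ := h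
  refine ⟨C * Real.exp p, fun ε hε hε1 => (h 1 le_rfl ε hε hε1).trans_eq ?_⟩
  rw [Real.rpow_def_of_pos (inv_pos.mpr hε), mul_assoc C, ← Real.exp_add, Nat.cast_one,
    Real.log_one]
  congr 2
  ring

theorem IsFrequencyCount.liminf_pos_of_pt (hN : IsFrequencyCount r g N) (hg : ∀ k, 0 < g k)
    (hg1 : g 0 ≤ 1) (hg_anti : Antitone g) (hr0 : 0 < r 0) (hr : Monotone r) (h : PT N) :
    0 < liminf (fun k : ℕ =>
      ENNReal.ofReal (Real.log (g k)⁻¹ / Real.log ((k : ℝ) + 1))) atTop := by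
  obtain ⟨C, p, q, -, -, hq, h⟩ := h
  have hp : 0 < p := (one_div_pos.mpr hr0).trans_le <| hN.one_div_le hg hg1 hr0 hr (C := C)
    fun ε hε hε1 => by simpa using h 1 le_rfl ε hε hε1
  -- any number `m > q` of nonzero entries will do
  obtain ⟨m, hm⟩ := exists_nat_gt q
  have hm0 : (0 : ℝ) < m := hq.trans_lt hm
  refine lt_of_lt_of_le ?_ (hN.ofReal_le_liminf hg hg1 hg_anti hr0 hr hp h (m := m)
    (by exact_mod_cast hm0))
  have := sub_pos.mpr hm
  exact ENNReal.ofReal_pos.mpr (by positivity)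

theorem IsFrequencyCount.le_of_sptBound (hN : IsFrequencyCount r g N) (hg : ∀ k, 0 < g k)
    (hg1 : g 0 ≤ 1) (hg_anti : Antitone g) (hr0 : 0 < r 0) (hr : Monotone r) {p : ℝ}
    (h : SPTBound N p) :
    1 / r 0 ≤ p ∧ 2 / liminf (fun k : ℕ =>
      ENNReal.ofReal (Real.log (g k)⁻¹ / Real.log ((k : ℝ) + 1))) atTop ≤ ENNReal.ofReal p := by
  obtain ⟨C, -, h⟩ := h
  have h1 : 1 / r 0 ≤ p := hN.one_div_le hg hg1 hr0 hr (h 1 le_rfl)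
  have hp : 0 < p := (one_div_pos.mpr hr0).trans_le h1
  refine ⟨h1, two_div_le_ofReal hp ?_⟩
  have h2 := hN.ofReal_le_liminf hg hg1 hg_anti hr0 hr hp (C := C) (q := 0) (m := 1)
    (fun d hd ε hε hε1 => by simpa using h d hd ε hε hε1) one_pos
  simpa using h2

theorem IsFrequencyCount.le_of_qptBound (hN : IsFrequencyCount r g N) (hg : ∀ k, 0 < g k)
    (hg1 : ∀ k, g k ≤ 1) (hr0 : 0 < r 0) (hr : Monotone r) {p : ℝ} (h : QPTBound N p) :
    1 / r 0 ≤ p ∧ 2 / (⨆ k, ENNReal.ofReal (Real.log (g k)⁻¹)) ≤ ENNReal.ofReal p := by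
  obtain ⟨C, hC⟩ := h.univariate
  have h1 : 1 / r 0 ≤ p := hN.one_div_le hg (hg1 0) hr0 hr hC
  have hp : 0 < p := (one_div_pos.mpr hr0).trans_le h1
  refine ⟨h1, two_div_le_ofReal hp ?_⟩
  set B : ℝ≥0∞ := ⨆ k, ENNReal.ofReal (Real.log (g k)⁻¹) with hB
  by_cases hBtop : B = ⊤
  · rw [hBtop]
    exact le_top
  rw [ENNReal.ofReal_le_iff_le_toReal hBtop, div_le_iff₀ hp, mul_comm]
  refine hN.two_le_mul hg hr0 hr ENNReal.toReal_nonneg (fun k => ?_) h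
  rw [← ENNReal.ofReal_le_iff_le_toReal hBtop, hB]
  exact le_iSup (fun k => ENNReal.ofReal (Real.log (g k)⁻¹)) k

end

end Tractability
end

theorem mainTheorem2 (r g : ℕ → ℝ)
    (hg_pos : ∀ k, 0 < g k) (hg_one : g 0 ≤ 1) (hg_anti : Antitone g)
    (hr_pos : 0 < r 0) (hr_mono : Monotone r)
    (X : Tractability.ErrorCriterion)
    (N : ℕ → ℝ → ℕ) (hN : N = Tractability.appComplexity X r g hg_pos)
    (A : ENNReal)
    (hA : A = Filter.liminf
      (fun k : ℕ => ENNReal.ofReal (Real.log (g k)⁻¹ / Real.log ((k : ℝ) + 1))) Filter.atTop) :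
    -- the minimum that defines the information complexity exists
    (∀ d : ℕ, 1 ≤ d → ∀ ε : ℝ, 0 < ε → ε < 1 →
      (Tractability.admissibleNumbers X (Tractability.APP r g hg_pos d) ε).Nonempty) ∧
    -- strong polynomial tractability and its exponent
    ((Tractability.SPT N ↔ 0 < A) ∧
      (Tractability.SPT N →
        Tractability.sptExponent N = max (2 / A) (ENNReal.ofReal (1 / r 0)))) ∧
    -- polynomial tractability
    (Tractability.SPT N ↔ Tractability.PT N) ∧
    -- quasi-polynomial tractability and its exponent
    (∃ B : ENNReal,
      Filter.Tendsto (fun k : ℕ => ENNReal.ofReal (Real.log (g k)⁻¹)) Filter.atTop (nhds B) ∧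
      (Tractability.QPT N ↔ 0 < B) ∧
      (Tractability.QPT N ↔ ∃ k, g k ≠ 1) ∧
      (Tractability.QPT N →
        Tractability.qptExponent N = max (2 / B) (ENNReal.ofReal (1 / r 0)))) ∧
    -- the weak notions of tractability
    ((Tractability.QPT N ↔ Tractability.UWT N) ∧
      (∀ s t : ℝ, 0 < s → 0 < t → t ≤ 1 → (Tractability.QPT N ↔ Tractability.STWT s t N)) ∧
      (Tractability.QPT N ↔ Tractability.WT N)) ∧
    (∀ s t : ℝ, 0 < s → 1 < t → Tractability.STWT s t N) ∧
    -- the curse of dimensionality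
    ((∀ k, g k = 1) → Tractability.CurseOfDimensionality N) := by
  open Tractability in
  have hg1 : ∀ k, g k ≤ 1 := fun k => (hg_anti (Nat.zero_le k)).trans hg_one
  have hr : ∀ k, 0 < r k := fun k => hr_pos.trans_le (hr_mono (Nat.zero_le k))
  have hfin : ∀ (d : ℕ) (ε : ℝ), (lowFrequencies d r g (ε⁻¹ ^ 2)).Finite := fun d ε =>
    lowFrequencies_finite hg_pos hr_pos hr_mono (sq_nonneg _)
  have hF : IsFrequencyCount r g N := fun d ε hε hε1 => by
    rw [hN, appComplexity_eq_ncard X hg1 hr hε hε1 (hfin d ε)]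
  have hr0 : 0 < 1 / r 0 := one_div_pos.mpr hr_pos
  have hspt : ∀ p, 1 / r 0 < p → 2 / A < ENNReal.ofReal p → SPTBound N p := fun p hp hAp =>
    hF.sptBound hg_pos hr_pos hr_mono hp (hA ▸ hAp)
  have hspt_pt : SPT N → PT N := by
    rintro ⟨p, hp, C, hC, h⟩
    exact ⟨C, p, 0, hC, hp, le_rfl, fun d hd ε hε hε1 => by simpa using h d hd ε hε hε1⟩
  have hpt_A : PT N → 0 < A := fun h =>
    hA ▸ hF.liminf_pos_of_pt hg_pos hg_one hg_anti hr_pos hr_mono h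
  have hA_spt : 0 < A → SPT N := fun h => by
    obtain ⟨p, hp, hAp⟩ := exists_exponent_gt (L := 2 / A)
      (ENNReal.div_ne_top ENNReal.ofNat_ne_top h.ne') (1 / r 0)
    exact ⟨p, (hr0.trans hp).le, hspt p hp hAp⟩
  -- the limit of the monotone sequence `log (g k)⁻¹`
  set B : ENNReal := ⨆ k, ENNReal.ofReal (Real.log (g k)⁻¹) with hB
  have hqpt : ∀ p, 1 / r 0 < p → 2 / B < ENNReal.ofReal p → QPTBound N p := fun p hp hBp => by
    obtain ⟨J, hJ⟩ := lt_iSup_iff.mp (ofReal_two_div_lt (hr0.trans hp) hBp)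
    exact hF.qptBound hg_pos hg_one hg_anti hr_pos hr_mono hp
      (ENNReal.ofReal_lt_ofReal_iff'.mp hJ).1
  have hqpt_B : QPT N ↔ 0 < B := by
    constructor
    · rintro ⟨p, -, h⟩
      rw [pos_iff_ne_zero]
      intro h0
      have h1 := (hF.le_of_qptBound hg_pos hg1 hr_pos hr_mono h).2
      rw [← hB, h0, ENNReal.div_zero two_ne_zero, top_le_iff] at h1
      exact ENNReal.ofReal_ne_top h1
    · intro h
      obtain ⟨p, hp, hBp⟩ := exists_exponent_gt (L := 2 / B)
        (ENNReal.div_ne_top ENNReal.ofNat_ne_top h.ne') (1 / r 0)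
      exact ⟨p, hr0.trans hp, hqpt p hp hBp⟩
  have hB_g : 0 < B ↔ ∃ k, g k ≠ 1 := by
    rw [hB, lt_iSup_iff]
    refine exists_congr fun k => ?_
    rw [ENNReal.ofReal_pos, Real.log_pos_iff (inv_pos.mpr (hg_pos k)).le,
      one_lt_inv₀ (hg_pos k)]
    exact ⟨fun h => h.ne, fun h => lt_of_le_of_ne (hg1 k) h⟩
  have hstwt : ∀ s t : ℝ, 0 < s → 0 < t → t ≤ 1 → (QPT N ↔ STWT s t N) := by
    refine fun s t hs ht ht1 =>
      ⟨fun h => hF.stwt_of_qpt hg_pos hr_pos hr_mono h hs ht, fun h => ?_⟩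
    rw [hqpt_B, hB_g]
    by_contra! hall
    exact hF.not_stwt hr_pos hr_mono hall ht1 h
  have hwt : WT N ↔ STWT 1 1 N := by simp only [WT, STWT, Real.rpow_one]
  refine ⟨fun d _ ε hε hε1 => ?_, ⟨⟨fun h => hpt_A (hspt_pt h), hA_spt⟩, fun _ => ?_⟩,
    ⟨hspt_pt, fun h => hA_spt (hpt_A h)⟩,
    ⟨B, tendsto_atTop_iSup fun i j hij => ?_, hqpt_B, hqpt_B.trans hB_g, fun _ => ?_⟩,
    ⟨⟨fun h s t hs ht => hF.stwt_of_qpt hg_pos hr_pos hr_mono h hs ht, fun h => ?_⟩, hstwt, ?_⟩,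
    fun s t hs ht => hF.stwt_of_one_lt hg_pos hg1 hr_pos hr_mono hs ht,
    fun h => hF.curse hr_pos hr_mono h⟩
  · rw [admissibleNumbers_APP X hg1 hr hε hε1 (hfin d ε)]
    exact Set.nonempty_Ici
  · refine iInf_exponent_eq_max (fun p hp => ?_)
      fun p hp hAp => ⟨(hr0.trans hp).le, hspt p hp hAp⟩
    rw [hA]
    exact hF.le_of_sptBound hg_pos hg_one hg_anti hr_pos hr_mono hp.2
  · exact ENNReal.ofReal_le_ofReal (Real.log_le_log (inv_pos.mpr (hg_pos i))
      (inv_anti₀ (hg_pos j) (hg_anti hij)))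
  · exact iInf_exponent_eq_max
      (fun p hp => hF.le_of_qptBound hg_pos hg1 hr_pos hr_mono hp.2)
      fun p hp hBp => ⟨hr0.trans hp, hqpt p hp hBp⟩
  · exact (hstwt 1 1 one_pos one_pos le_rfl).mpr (h 1 1 one_pos one_pos)
  · rw [hwt]
    exact hstwt 1 1 one_pos one_pos le_rfl
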